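/- A theory $T$ is a functor $n\mapsto T(n)$ from the category of the finite sets $\{1,\dots,n\}$ ($n\ge 0$) and all maps to sets, with compositions $\gamma:T(k)\times T(n_1)\times\dots\times T(n_k)\to T(n_1+\dots+n_k)$ and a unit $1\in T(1)$, which are associative, unital and equivariant in both arguments with respect to all maps. A categorical theory is a theory internal to categories: its objects and its morphisms form theories, and source, target, identities and composition are morphisms of theories. For a category $X$, the functors $X^n\to X$ and the natural transformations between them form a categorical theory $\mathrm{End}(X)$; an algebra over a categorical theory $C$ is a category $X$ with a morphism $C\to\mathrm{End}(X)$ of categorical theories. A strict algebra over a theory $T$ is an algebra over $T$ regarded as a categorical theory with identity morphisms only. Let $S(n)\subseteq T(n)$, $n\ge 0$, be arbitrary subsets (a Laplaza set for $T$). Let $T'_S$ be the following categorical theory. Its theory of objects is the free theory on the collection $\{S(n)\}_{n\ge0}$, which projects to $T$. Its morphisms are generated, under the operations of a categorical theory, by one arrow $\iota_{a,b}:a\to b$ for each pair of objects $a,b$ with $n$ variables that project to the same element of $S(n)$, where $\iota_{a,a}=\mathrm{Id}_a$, subject to the relations $\iota_{a,b}=\iota_{b,a}^{-1}$ and $\alpha=\beta$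 whenever $\alpha,\beta:x\to y$ are parallel morphisms with $n$ variables such that $x$ and $y$ project to the same element of $S(n)$. A pseudo $(T,S)$-algebra is an algebra over $T'_S$. Every strict $T$-algebra is a pseudo $(T,S)$-algebra through the projection $T'_S\to T$. A pseudo morphism of pseudo $(T,S)$-algebras is a functor $F$ with natural isomorphisms $F(w(x_1,\dots,x_n))\cong w(F(x_1),\dots,F(x_n))$ for all words $w$, compatible with the coherence maps (the actions of the morphisms of $T'_S$) and with the unit, the renaming of variables and the composition of words; a 2-cell is a natural transformation compatible with these isomorphisms. Two pseudo algebras are equivalent if there are pseudo morphisms in both directions whose two composites are isomorphic, by invertible 2-cells, to the identities. **Proposition.** Let $T$ be the theory of commutative monoids, so that $T(n)$ is the free commutative monoid on $n$ generators, and take the Laplaza set $S=T$. Then every pseudo $(T,T)$-algebra $A$ is equivalent to a strictly symmetric monoidal category, i.e. there is a category $A'$ which is a strict algebra over the theory of commutative monoids and which, regarded as a pseudo $(T,T)$-algebra, is equivalent to $A$. -/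

import Mathlib

open CategoryTheory

universe v u w

namespace Laplaza

section Blocks

variable {k : ℕ} {n : Fin k → ℕ}

/-- The `j`-th element of the `i`-th block of `n₁ + ⋯ + n_k`. -/
def blk (i : Fin k) (j : Fin (n i)) : Fin (∑ i, n i) := finSigmaFinEquiv ⟨i, j⟩

/-- The block to which an element of `n₁ + ⋯ + n_k` belongs, and its position there. -/
def unblk (p : Fin (∑ i, n i)) : (i : Fin k) × Fin (n i) := finSigmaFinEquiv.symm p

@[simp] theorem unblk_blk (i : Fin k) (j : Fin (n i)) : unblk (blk i j) = ⟨i, j⟩ :=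
  finSigmaFinEquiv.symm_apply_apply _

@[simp] theorem blk_unblk (p : Fin (∑ i, n i)) : blk (unblk p).1 (unblk p).2 = p :=
  finSigmaFinEquiv.apply_symm_apply _

/-- The sizes `l i j`, listed in one row: `l 1 1, …, l 1 n₁, l 2 1, …, l k n_k`. -/
abbrev flat (l : ∀ i, Fin (n i) → ℕ) (p : Fin (∑ i, n i)) : ℕ := l (unblk p).1 (unblk p).2

/-- The canonical bijection between the sum of all the `l i j`, taken in one row, and the
iterated sum `∑ i, ∑ j, l i j` (two names for the same natural number). -/
def regroup (l : ∀ i, Fin (n i) → ℕ) (p : Fin (∑ p, flat l p)) : Fin (∑ i, ∑ j, l i j) :=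
  blk (n := fun i => ∑ j, l i j) (unblk (unblk p).1).1
    (blk (n := l (unblk (unblk p).1).1) (unblk (unblk p).1).2 (unblk p).2)

/-- The function `f̄` that moves entire blocks according to `f`. -/
def moveBlocks {m : ℕ} (f : Fin m → Fin k) (p : Fin (∑ i, n (f i))) : Fin (∑ i, n i) :=
  blk (f (unblk p).1) (unblk (n := fun i => n (f i)) p).2

/-- The function `g₁ + ⋯ + g_k` obtained by placing the `g i` next to each other. -/
def sumMap {n' : Fin k → ℕ} (g : ∀ i, Fin (n i) → Fin (n' i)) (p : Fin (∑ i, n i)) :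
    Fin (∑ i, n' i) :=
  blk (unblk p).1 (g (unblk p).1 (unblk p).2)

@[simp] theorem moveBlocks_blk {m : ℕ} (f : Fin m → Fin k) (i : Fin m) (j : Fin (n (f i))) :
    moveBlocks (n := n) f (blk (n := fun i => n (f i)) i j) = blk (f i) j := by
  have h : ∀ z : (i : Fin m) × Fin (n (f i)), z = ⟨i, j⟩ → blk (n := n) (f z.1) z.2 = blk (f i) j := by
    rintro _ rfl; rfl
  exact h _ (unblk_blk (n := fun i => n (f i)) i j)

@[simp] theorem sumMap_blk {n' : Fin k → ℕ} (g : ∀ i, Fin (n i) → Fin (n' i)) (i : Fin k)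
    (j : Fin (n i)) : sumMap g (blk i j) = blk i (g i j) := by
  have h : ∀ z : (i : Fin k) × Fin (n i), z = ⟨i, j⟩ →
      blk (n := n') z.1 (g z.1 z.2) = blk i (g i j) := by
    rintro _ rfl; rfl
  exact h _ (unblk_blk i j)

theorem regroup_blk (l : ∀ i, Fin (n i) → ℕ) (p : Fin (∑ i, n i)) (t : Fin (flat l p)) :
    regroup l (blk p t) =
      blk (n := fun i => ∑ j, l i j) (unblk p).1 (blk (n := l (unblk p).1) (unblk p).2 t) := by
  have h : ∀ z : (p : Fin (∑ i, n i)) × Fin (flat l p), z = ⟨p, t⟩ →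
      blk (n := fun i => ∑ j, l i j) (unblk z.1).1 (blk (n := l (unblk z.1).1) (unblk z.1).2 z.2) =
      blk (n := fun i => ∑ j, l i j) (unblk p).1 (blk (n := l (unblk p).1) (unblk p).2 t) := by
    rintro _ rfl; rfl
  exact h _ (unblk_blk p t)

theorem flat_blk {β : Sort w} (l : ∀ i, Fin (n i) → ℕ)
    (F : ∀ i (j : Fin (n i)), (Fin (l i j) → Fin (∑ i, ∑ j, l i j)) → β) (i : Fin k)
    (j : Fin (n i)) :
    F (unblk (blk i j)).1 (unblk (blk i j)).2 (fun t => regroup l (blk (blk i j) t)) =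
      F i j (fun t => blk (n := fun i => ∑ j, l i j) i (blk j t)) := by
  have h : (fun t => regroup l (blk (blk i j) t)) = fun t =>
      blk (n := fun i => ∑ j, l i j) (unblk (blk i j)).1
        (blk (n := l (unblk (blk i j)).1) (unblk (blk i j)).2 t) :=
    funext (regroup_blk l (blk i j))
  have h2 : ∀ z : (i : Fin k) × Fin (n i), z = ⟨i, j⟩ →
      F z.1 z.2 (fun t => blk (n := fun i => ∑ j, l i j) z.1 (blk (n := l z.1) z.2 t)) =
      F i j (fun t => blk (n := fun i => ∑ j, l i j) i (blk j t)) := by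
    rintro _ rfl; rfl
  exact (congrArg (F _ _) h).trans (h2 _ (unblk_blk i j))

end Blocks

/-- Theories, in the style of universal algebra: a functor `n ↦ W n` from the category of the finite
sets `{1, …, n}` and all maps to sets, with compositions `γ` and a unit. -/
structure Theory where
  W : ℕ → Type u
  map {m n : ℕ} (f : Fin m → Fin n) : W m → W n
  one : W 1
  γ {k : ℕ} {n : Fin k → ℕ} (w : W k) (v : ∀ i, W (n i)) : W (∑ i, n i)
  map_id {n : ℕ} (w : W n) : map id w = w
  map_map {l m n : ℕ} (g : Fin m → Fin n) (f : Fin l → Fin m) (w : W l) :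
    map g (map f w) = map (g ∘ f) w
  γ_assoc {k : ℕ} {n : Fin k → ℕ} {l : ∀ i, Fin (n i) → ℕ} (w : W k) (v : ∀ i, W (n i))
    (u : ∀ i j, W (l i j)) :
    γ w (fun i => γ (v i) (u i)) =
      map (regroup l) (γ (n := flat l) (γ w v) (fun p => u (unblk p).1 (unblk p).2))
  γ_one {k : ℕ} (w : W k) :
    map (fun p => (unblk p).1) (γ w (fun _ : Fin k => one)) = w
  one_γ {n : ℕ} (w : W n) :
    map (fun p => (unblk (n := fun _ : Fin 1 => n) p).2) (γ one (fun _ : Fin 1 => w)) = w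
  γ_map_left {k l : ℕ} {n : Fin l → ℕ} (f : Fin k → Fin l) (w : W k) (v : ∀ i, W (n i)) :
    γ (map f w) v = map (moveBlocks f) (γ w (fun i => v (f i)))
  γ_map_right {k : ℕ} {n n' : Fin k → ℕ} (g : ∀ i, Fin (n i) → Fin (n' i)) (w : W k)
    (v : ∀ i, W (n i)) :
    γ w (fun i => map (g i) (v i)) = map (sumMap g) (γ w v)

/-- Morphisms of theories. -/
structure TheoryHom (T : Theory.{u}) (T' : Theory.{v}) where
  app {n : ℕ} : T.W n → T'.W n
  app_map {m n : ℕ} (f : Fin m → Fin n) (w : T.W m) : app (T.map f w) = T'.map f (app w)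
  app_one : app T.one = T'.one
  app_γ {k : ℕ} {n : Fin k → ℕ} (w : T.W k) (v : ∀ i, T.W (n i)) :
    app (T.γ w v) = T'.γ (app w) (fun i => app (v i))

/-- The theory of commutative monoids. An `n`-ary operation is an element of the free
commutative monoid on the variables `1, …, n`: the multiset `w` stands for the operation
`(x₁, …, x_n) ↦ ∑ i ∈ w, x_i`. -/
def commMonoidTheory : Theory.{0} where
  W n := Multiset (Fin n)
  map f w := w.map f
  one := {0}
  γ w v := w.bind fun i => (v i).map (blk i)
  map_id w := by simp
  map_map g f w := by simp
  γ_assoc w v u := by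
    simp only [Multiset.map_bind, Multiset.bind_assoc, Multiset.bind_map, Multiset.map_map]
    refine Multiset.bind_congr fun i _ => Multiset.bind_congr fun j _ => ?_
    exact (flat_blk _ (fun i j f => (u i j).map f) i j).symm
  γ_one w := by
    simp
  one_γ w := by
    simp
  γ_map_left f w v := by
    simp [Multiset.map_bind, Multiset.bind_map]
  γ_map_right g w v := by
    simp [Multiset.map_bind]

/-- The formal words in the variables `1, …, n` built from the operations in `Z`
(`Z k` holds the operations with `k` arguments); variables may repeat or be left out. -/
inductive Word (Z : ℕ → Type u) (n : ℕ) : Type u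
  | var : Fin n → Word Z n
  | op {k : ℕ} : Z k → (Fin k → Word Z n) → Word Z n

namespace Word

variable {Z : ℕ → Type u}

/-- Simultaneous substitution for the variables. -/
def subst {m n : ℕ} (s : Fin m → Word Z n) : Word Z m → Word Z n
  | var i => s i
  | op z t => op z fun i => subst s (t i)

/-- Renaming of the variables. -/
def rename {m n : ℕ} (f : Fin m → Fin n) (t : Word Z m) : Word Z n := t.subst fun i => var (f i)

theorem subst_subst {l m n : ℕ} (s : Fin l → Word Z m) (r : Fin m → Word Z n) (t : Word Z l) :
    (t.subst s).subst r = t.subst fun i => (s i).subst r := by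
  induction t with
  | var i => rfl
  | op z t ih => simp only [subst, ih]

theorem subst_var {n : ℕ} (t : Word Z n) : t.subst var = t := by
  induction t with
  | var i => rfl
  | op z t ih => simp only [subst, ih]

end Word

/-- The free theory on the collection `Z`. -/
def freeTheory (Z : ℕ → Type u) : Theory.{u} where
  W n := Word Z n
  map f t := t.rename f
  one := Word.var 0
  γ t s := t.subst fun i => (s i).rename (blk i)
  map_id t := t.subst_var
  map_map g f t := by simp only [Word.rename, Word.subst_subst]; rfl
  γ_assoc t s r := by
    simp only [Word.rename, Word.subst_subst, Word.subst]
    congr 1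
    funext i
    congr 1
    funext j
    exact (flat_blk _ (fun i j f => (r i j).subst fun t => Word.var (f t)) i j).symm
  γ_one t := by
    simp only [Word.rename, Word.subst_subst, Word.subst, unblk_blk, Word.subst_var]
  one_γ t := by
    simp only [Word.rename, Word.subst_subst, Word.subst, unblk_blk, Word.subst_var]
  γ_map_left f t s := by
    simp only [Word.rename, Word.subst_subst, Word.subst, moveBlocks_blk]
  γ_map_right g t s := by
    simp only [Word.rename, Word.subst_subst, Word.subst, sumMap_blk]

section Lift

variable (T : Theory.{u})

/-- Substitution in an arbitrary theory: all the words `v i` have the same variables. -/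
def Theory.subst {k n : ℕ} (w : T.W k) (v : Fin k → T.W n) : T.W n :=
  T.map (fun p => (unblk p).2) (T.γ w v)

theorem Theory.map_subst {k m n : ℕ} (f : Fin m → Fin n) (w : T.W k) (v : Fin k → T.W m) :
    T.map f (T.subst w v) = T.subst w fun i => T.map f (v i) := by
  simp only [Theory.subst, T.γ_map_right (fun _ => f), T.map_map]
  congr 1
  funext p
  simp [sumMap]

theorem Theory.subst_map {k l n : ℕ} (f : Fin k → Fin l) (w : T.W k) (v : Fin l → T.W n) :
    T.subst (T.map f w) v = T.subst w fun i => v (f i) := by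
  simp only [Theory.subst, T.γ_map_left, T.map_map]
  congr 1
  funext p
  simp [moveBlocks]

theorem Theory.γ_eq_subst {k : ℕ} {n : Fin k → ℕ} (w : T.W k) (v : ∀ i, T.W (n i)) :
    T.γ w v = T.subst w fun i => T.map (blk i) (v i) := by
  simp only [Theory.subst, T.γ_map_right (fun i => blk i), T.map_map]
  conv_lhs => rw [← T.map_id (T.γ w v)]
  congr 1
  funext p
  simp [sumMap]

theorem Theory.subst_one {n : ℕ} (v : Fin 1 → T.W n) : T.subst T.one v = v 0 := by
  have : v = fun _ => v 0 := by funext i; rw [Subsingleton.elim i 0]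
  rw [this]
  exact T.one_γ (v 0)

theorem Theory.subst_subst {k l n : ℕ} (w : T.W k) (v : Fin k → T.W l) (u : Fin l → T.W n) :
    T.subst (T.subst w v) u = T.subst w fun i => T.subst (v i) u := by
  have h := T.γ_assoc (l := fun _ _ => n) w v (fun _ j => u j)
  have h2 : T.subst (T.subst w v) u =
      T.subst (T.γ w v) (fun p => u (unblk (n := fun _ : Fin k => l) p).2) := T.subst_map _ _ _
  rw [h2]
  have h3 : (fun i => T.subst (v i) u) =
    fun i => T.map (fun p => (unblk (n := fun _ : Fin l => n) p).2) (T.γ (v i) u) := rfl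
  have h4 := T.γ_map_right (fun _ : Fin k => fun p => (unblk (n := fun _ : Fin l => n) p).2) w
    (fun i => T.γ (v i) u)
  rw [h3, Theory.subst, Theory.subst, h4, h, T.map_map, T.map_map]
  congr 1
  funext p
  rw [← blk_unblk p]
  generalize unblk p = z
  obtain ⟨q, t⟩ := z
  have e1 := regroup_blk (n := fun _ : Fin k => l) (fun _ _ => n) q t
  have e2 := sumMap_blk (n := fun _ : Fin k => ∑ _ : Fin l, n) (n' := fun _ : Fin k => n)
    (fun _ => fun p => (unblk (n := fun _ : Fin l => n) p).2) (unblk q).1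
    (blk (n := fun _ : Fin l => n) (unblk q).2 t)
  have e3 : ∀ {a : ℕ} {m : ℕ} (i : Fin a) (j : Fin m),
      (unblk (n := fun _ : Fin a => m) (blk i j)).2 = j := fun {a m} i j => by
    rw [unblk_blk]
  refine (e3 (a := ∑ _ : Fin k, l) q t).trans (Eq.symm ?_)
  refine (congrArg (fun z => (unblk (n := fun _ : Fin k => n) (sumMap (n' := fun _ : Fin k => n)
    (fun _ => fun p => (unblk (n := fun _ : Fin l => n) p).2) z)).2) e1).trans ?_
  refine (congrArg (fun z => (unblk (n := fun _ : Fin k => n) z).2) e2).trans ?_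
  exact (e3 (a := k) _ _).trans (e3 (a := l) _ _)

variable {T} {Z : ℕ → Type w} (φ : ∀ {n : ℕ}, Z n → T.W n)

/-- The value of a formal word in a theory `T` in which the operations in `Z` are interpreted. -/
def Word.eval {n : ℕ} : Word Z n → T.W n
  | var i => T.map (fun _ => i) T.one
  | op z t => T.subst (φ z) fun i => eval (t i)

theorem Word.eval_subst {m n : ℕ} (s : Fin m → Word Z n) (t : Word Z m) :
    (t.subst s).eval φ = T.subst (t.eval φ) fun i => (s i).eval φ := by
  induction t with
  | var i => simp only [Word.subst, Word.eval, T.subst_map, T.subst_one]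
  | op z t ih => simp only [Word.subst, Word.eval, ih, T.subst_subst]

theorem Word.eval_rename {m n : ℕ} (f : Fin m → Fin n) (t : Word Z m) :
    (t.rename f).eval φ = T.map f (t.eval φ) := by
  induction t with
  | var i => simp only [Word.rename, Word.subst, Word.eval, T.map_map]; rfl
  | op z t ih =>
    simp only [Word.rename] at ih
    simp only [Word.rename, Word.subst, Word.eval, T.map_subst, ih]

/-- The morphism of theories from the free theory that extends an interpretation of `Z`. -/
def freeTheoryLift : TheoryHom (freeTheory Z) T where
  app t := t.eval φ
  app_map f t := t.eval_rename φ f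
  app_one := by
    refine Eq.trans ?_ (T.map_id T.one)
    exact congrArg (fun f => T.map f T.one) (Subsingleton.elim _ _)
  app_γ t s := by
    rw [T.γ_eq_subst]
    refine (Word.eval_subst φ _ t).trans ?_
    congr 1
    funext i
    exact Word.eval_rename φ (blk i) (s i)

end Lift

/-- Categorical theories, i.e. theories internal to categories: objects and morphisms form
theories, source, target, identity and composition are morphisms of theories, and the
axioms of a category hold. Composition is written in diagrammatic order. -/
structure CatTheory where
  Obj : Theory.{u}
  Mor : Theory.{u}
  src : TheoryHom Mor Obj
  tgt : TheoryHom Mor Obj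
  idn : TheoryHom Obj Mor
  comp {n : ℕ} (f g : Mor.W n) (h : tgt.app f = src.app g) : Mor.W n
  src_idn {n : ℕ} (a : Obj.W n) : src.app (idn.app a) = a
  tgt_idn {n : ℕ} (a : Obj.W n) : tgt.app (idn.app a) = a
  src_comp {n : ℕ} (f g : Mor.W n) (h : tgt.app f = src.app g) : src.app (comp f g h) = src.app f
  tgt_comp {n : ℕ} (f g : Mor.W n) (h : tgt.app f = src.app g) : tgt.app (comp f g h) = tgt.app g
  idn_comp {n : ℕ} (f : Mor.W n) : comp (idn.app (src.app f)) f (tgt_idn _) = f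
  comp_idn {n : ℕ} (f : Mor.W n) : comp f (idn.app (tgt.app f)) (src_idn _).symm = f
  comp_assoc {n : ℕ} (f g k : Mor.W n) (h : tgt.app f = src.app g) (h' : tgt.app g = src.app k) :
    comp (comp f g h) k ((tgt_comp f g h).trans h') =
      comp f (comp g k h') (h.trans (src_comp g k h').symm)
  map_comp {m n : ℕ} (φ : Fin m → Fin n) (f g : Mor.W m) (h : tgt.app f = src.app g) :
    Mor.map φ (comp f g h) = comp (Mor.map φ f) (Mor.map φ g)
      (by rw [tgt.app_map, src.app_map, h])
  γ_comp {k : ℕ} {n : Fin k → ℕ} (f g : Mor.W k) (h : tgt.app f = src.app g)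
    (p q : ∀ i, Mor.W (n i)) (h' : ∀ i, tgt.app (p i) = src.app (q i)) :
    Mor.γ (comp f g h) (fun i => comp (p i) (q i) (h' i)) = comp (Mor.γ f p) (Mor.γ g q)
      (by rw [tgt.app_γ, src.app_γ, h]; simp only [h'])

/-- Morphisms of categorical theories. -/
structure CatTheoryHom (C : CatTheory.{u}) (D : CatTheory.{v}) where
  obj : TheoryHom C.Obj D.Obj
  mor : TheoryHom C.Mor D.Mor
  src_mor {n : ℕ} (f : C.Mor.W n) : D.src.app (mor.app f) = obj.app (C.src.app f)
  tgt_mor {n : ℕ} (f : C.Mor.W n) : D.tgt.app (mor.app f) = obj.app (C.tgt.app f)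
  mor_idn {n : ℕ} (a : C.Obj.W n) : mor.app (C.idn.app a) = D.idn.app (obj.app a)
  mor_comp {n : ℕ} (f g : C.Mor.W n) (h : C.tgt.app f = C.src.app g) :
    mor.app (C.comp f g h) = D.comp (mor.app f) (mor.app g)
      (by rw [tgt_mor, src_mor, h])

/-- Composites of morphisms of theories. -/
def TheoryHom.trans {T : Theory.{u}} {T' : Theory.{v}} {T'' : Theory.{w}} (φ : TheoryHom T T')
    (ψ : TheoryHom T' T'') : TheoryHom T T'' where
  app x := ψ.app (φ.app x)
  app_map f x := by rw [φ.app_map, ψ.app_map]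
  app_one := by rw [φ.app_one, ψ.app_one]
  app_γ x y := by rw [φ.app_γ, ψ.app_γ]

/-- Composites of morphisms of categorical theories. -/
def CatTheoryHom.trans {C : CatTheory.{u}} {D : CatTheory.{v}} {E : CatTheory.{w}}
    (Φ : CatTheoryHom C D) (Ψ : CatTheoryHom D E) : CatTheoryHom C E where
  obj := Φ.obj.trans Ψ.obj
  mor := Φ.mor.trans Ψ.mor
  src_mor f := by simp only [TheoryHom.trans, Ψ.src_mor, Φ.src_mor]
  tgt_mor f := by simp only [TheoryHom.trans, Ψ.tgt_mor, Φ.tgt_mor]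
  mor_idn a := by simp only [TheoryHom.trans, Ψ.mor_idn, Φ.mor_idn]
  mor_comp f g h := by simp only [TheoryHom.trans, Ψ.mor_comp, Φ.mor_comp]

/-- The identity morphism of a theory. -/
def TheoryHom.refl (T : Theory.{u}) : TheoryHom T T where
  app x := x
  app_map _ _ := rfl
  app_one := rfl
  app_γ _ _ := rfl

/-- A theory, considered as a categorical theory with identity morphisms only. -/
def discreteTheory (T : Theory.{u}) : CatTheory.{u} where
  Obj := T
  Mor := T
  src := TheoryHom.refl T
  tgt := TheoryHom.refl T
  idn := TheoryHom.refl T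
  comp f _ _ := f
  src_idn _ := rfl
  tgt_idn _ := rfl
  src_comp _ _ _ := rfl
  tgt_comp _ _ h := h
  idn_comp _ := rfl
  comp_idn _ := rfl
  comp_assoc _ _ _ _ _ := rfl
  map_comp _ _ _ _ := rfl
  γ_comp _ _ _ _ _ _ := rfl

section End

attribute [local irreducible] blk unblk moveBlocks sumMap regroup

variable (X : Type u) [Category.{v} X]

/-- The functor `X^n ⥤ X^m` that reindexes tuples along `f`. -/
abbrev reindex {m n : ℕ} (f : Fin m → Fin n) : (Fin n → X) ⥤ (Fin m → X) :=
  Functor.pi' fun i => Pi.eval (fun _ : Fin n => X) (f i)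

variable {X}

/-- Composition of functors of several variables. -/
abbrev plug {k : ℕ} {n : Fin k → ℕ} (F : (Fin k → X) ⥤ X) (G : ∀ i, (Fin (n i) → X) ⥤ X) :
    (Fin (∑ i, n i) → X) ⥤ X :=
  Functor.pi' (fun i => reindex X (blk i) ⋙ G i) ⋙ F

/-- A tuple of natural transformations, as a natural transformation between functors to `X^k`. -/
def tupleMap {D : Type w} [Category.{v} D] {k : ℕ} {F G : Fin k → D ⥤ X} (β : ∀ i, F i ⟶ G i) :
    Functor.pi' F ⟶ Functor.pi' G where
  app x i := (β i).app x
  naturality x y f := by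
    funext i
    exact (β i).naturality f

/-- Horizontal composition of natural transformations between functors of several variables. -/
abbrev plugMap {k : ℕ} {n : Fin k → ℕ} {F F' : (Fin k → X) ⥤ X} (α : F ⟶ F')
    {G G' : ∀ i, (Fin (n i) → X) ⥤ X} (β : ∀ i, G i ⟶ G' i) : plug F G ⟶ plug F' G' :=
  tupleMap (fun i => Functor.whiskerLeft (reindex X (blk i)) (β i)) ◫ α

variable (X)

/-- `F(G₁(H₁₁, …), …, G_k(H_k₁, …))`, where the variables of `H i j` are chosen by `c`. -/
def plugTwice {k : ℕ} {n : Fin k → ℕ} {l : ∀ i, Fin (n i) → ℕ} {N : ℕ} (F : (Fin k → X) ⥤ X)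
    (G : ∀ i, (Fin (n i) → X) ⥤ X) (H : ∀ i j, (Fin (l i j) → X) ⥤ X)
    (c : ∀ i, Fin (n i) → (z : (i : Fin k) × Fin (n i)) × (Fin (l z.1 z.2) → Fin N)) :
    (Fin N → X) ⥤ X :=
  Functor.pi' (fun i => Functor.pi' (fun j =>
    reindex X (c i j).2 ⋙ H (c i j).1.1 (c i j).1.2) ⋙ G i) ⋙ F

theorem plug_assoc {k : ℕ} {n : Fin k → ℕ} {l : ∀ i, Fin (n i) → ℕ} (F : (Fin k → X) ⥤ X)
    (G : ∀ i, (Fin (n i) → X) ⥤ X) (H : ∀ i j, (Fin (l i j) → X) ⥤ X) :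
    plug F (fun i => plug (G i) (H i)) =
      reindex X (regroup l) ⋙ plug (n := flat l) (plug F G)
        (fun p => H (unblk p).1 (unblk p).2) := by
  have h : (fun i j => ⟨⟨i, j⟩, fun t => blk (n := fun i => ∑ j, l i j) i (blk j t)⟩ :
      ∀ i, Fin (n i) → (z : (i : Fin k) × Fin (n i)) ×
        (Fin (l z.1 z.2) → Fin (∑ i, ∑ j, l i j))) =
      fun i j => ⟨unblk (blk i j), fun t => regroup l (blk (blk i j) t)⟩ :=
    funext fun i => funext fun j => (flat_blk l (fun i j f => (⟨⟨i, j⟩, f⟩ :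
      (z : (i : Fin k) × Fin (n i)) × (Fin (l z.1 z.2) → Fin (∑ i, ∑ j, l i j)))) i j).symm
  have h1 : plug F (fun i => plug (G i) (H i)) = plugTwice X F G H
    (fun i j => ⟨⟨i, j⟩, fun t => blk (n := fun i => ∑ j, l i j) i (blk j t)⟩) := rfl
  have h2 : plugTwice X F G H
      (fun i j => ⟨unblk (blk i j), fun t => regroup l (blk (blk i j) t)⟩) =
      reindex X (regroup l) ⋙ plug (n := flat l) (plug F G)
        (fun p => H (unblk p).1 (unblk p).2) := rfl
  exact h1.trans ((congrArg (plugTwice X F G H) h).trans h2)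

/-- The theory formed by the functors `X^n ⥤ X`. -/
def endObj : Theory.{max u v} where
  W n := (Fin n → X) ⥤ X
  map f F := reindex X f ⋙ F
  one := Pi.eval (fun _ : Fin 1 => X) 0
  γ F G := plug F G
  map_id F := rfl
  map_map g f F := rfl
  γ_assoc F G H := plug_assoc X F G H
  γ_one {k} F := congrArg (fun c : Fin k → Fin k => reindex X c ⋙ F)
    (a₁ := fun i => (unblk (n := fun _ : Fin k => 1) (blk i 0)).1) (a₂ := fun i => i)
    (funext fun i => by rw [unblk_blk])
  one_γ {n} F := by
    have h : (fun j : Fin n => (unblk (n := fun _ : Fin 1 => n) (blk 0 j)).2) = fun j => j :=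
      funext fun j => by rw [unblk_blk]
    exact congrArg (fun c : Fin n → Fin n => reindex X c ⋙ F) h
  γ_map_left {k l n} f F G := congrArg
    (fun c : ∀ i, Fin (n (f i)) → Fin (∑ i, n i) =>
      Functor.pi' (fun i => reindex X (c i) ⋙ G (f i)) ⋙ F)
    (a₁ := fun i j => blk (f i) j)
    (a₂ := fun i j => moveBlocks f (blk (n := fun i => n (f i)) i j))
    (funext fun i => funext fun j => (moveBlocks_blk f i j).symm)
  γ_map_right {k n n'} g F G := congrArg
    (fun c : ∀ i, Fin (n i) → Fin (∑ i, n' i) => (Functor.pi' (fun i => reindex X (c i) ⋙ G i) ⋙ F))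
    (a₁ := fun i j => blk i (g i j)) (a₂ := fun i j => sumMap g (blk i j))
    (funext fun i => funext fun j => (sumMap_blk g i j).symm)

/-- The analogue of `plugTwice` for natural transformations. -/
def plugTwiceMap {k : ℕ} {n : Fin k → ℕ} {l : ∀ i, Fin (n i) → ℕ} {N : ℕ}
    (F : Arrow ((Fin k → X) ⥤ X)) (G : ∀ i, Arrow ((Fin (n i) → X) ⥤ X))
    (H : ∀ i j, Arrow ((Fin (l i j) → X) ⥤ X))
    (c : ∀ i, Fin (n i) → (z : (i : Fin k) × Fin (n i)) × (Fin (l z.1 z.2) → Fin N)) :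
    Arrow ((Fin N → X) ⥤ X) :=
  Arrow.mk (tupleMap (fun i => tupleMap (fun j =>
    Functor.whiskerLeft (reindex X (c i j).2) (H (c i j).1.1 (c i j).1.2).hom) ◫ (G i).hom) ◫ F.hom)

theorem plugMap_assoc {k : ℕ} {n : Fin k → ℕ} {l : ∀ i, Fin (n i) → ℕ}
    (F : Arrow ((Fin k → X) ⥤ X)) (G : ∀ i, Arrow ((Fin (n i) → X) ⥤ X))
    (H : ∀ i j, Arrow ((Fin (l i j) → X) ⥤ X)) :
    Arrow.mk (plugMap F.hom fun i => plugMap (G i).hom fun j => (H i j).hom) =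
      Arrow.mk (Functor.whiskerLeft (reindex X (regroup l))
        (plugMap (n := flat l) (plugMap F.hom fun i => (G i).hom)
          fun p => (H (unblk p).1 (unblk p).2).hom)) := by
  have h : (fun i j => ⟨⟨i, j⟩, fun t => blk (n := fun i => ∑ j, l i j) i (blk j t)⟩ :
      ∀ i, Fin (n i) → (z : (i : Fin k) × Fin (n i)) ×
        (Fin (l z.1 z.2) → Fin (∑ i, ∑ j, l i j))) =
      fun i j => ⟨unblk (blk i j), fun t => regroup l (blk (blk i j) t)⟩ :=
    funext fun i => funext fun j => (flat_blk l (fun i j f => (⟨⟨i, j⟩, f⟩ :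
      (z : (i : Fin k) × Fin (n i)) × (Fin (l z.1 z.2) → Fin (∑ i, ∑ j, l i j)))) i j).symm
  have h1 : Arrow.mk (plugMap F.hom fun i => plugMap (G i).hom fun j => (H i j).hom) =
      plugTwiceMap X F G H
        (fun i j => ⟨⟨i, j⟩, fun t => blk (n := fun i => ∑ j, l i j) i (blk j t)⟩) := rfl
  have h2 : plugTwiceMap X F G H
      (fun i j => ⟨unblk (blk i j), fun t => regroup l (blk (blk i j) t)⟩) =
      Arrow.mk (Functor.whiskerLeft (reindex X (regroup l))
        (plugMap (n := flat l) (plugMap F.hom fun i => (G i).hom)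
          fun p => (H (unblk p).1 (unblk p).2).hom)) := by
    refine congrArg Arrow.mk ?_
    ext x
    refine Eq.trans ?_ (Category.assoc _ _ _).symm
    refine congrArg (F.hom.app _ ≫ ·) ?_
    exact F.right.map_comp (Y := fun i => _) _ _
  exact h1.trans ((congrArg (plugTwiceMap X F G H) h).trans h2)

theorem one_plugMap {n : ℕ} {N : ℕ} (c : Fin n → Fin N) (F : Arrow ((Fin n → X) ⥤ X)) :
    Arrow.mk (tupleMap (fun _ : Fin 1 => Functor.whiskerLeft (reindex X c) F.hom) ◫
      𝟙 (Pi.eval (fun _ : Fin 1 => X) 0)) = Arrow.mk (Functor.whiskerLeft (reindex X c) F.hom) := by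
  have h : tupleMap (fun _ : Fin 1 => Functor.whiskerLeft (reindex X c) F.hom) ◫
      𝟙 (Pi.eval (fun _ : Fin 1 => X) 0) = Functor.whiskerLeft (reindex X c) F.hom := by
    ext x
    exact Category.id_comp _
  exact congrArg Arrow.mk h

theorem plugMap_one {k : ℕ} {N : ℕ} (c : Fin k → Fin N) (F : Arrow ((Fin k → X) ⥤ X)) :
    Arrow.mk (tupleMap (fun i : Fin k => 𝟙 (Pi.eval (fun _ : Fin N => X) (c i))) ◫ F.hom) =
      Arrow.mk (Functor.whiskerLeft (reindex X c) F.hom) := by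
  have h : tupleMap (fun i : Fin k => 𝟙 (Pi.eval (fun _ : Fin N => X) (c i))) ◫ F.hom =
      Functor.whiskerLeft (reindex X c) F.hom := by
    ext x
    exact (congrArg (F.hom.app _ ≫ ·) (F.right.map_id _)).trans (Category.comp_id _)
  exact congrArg Arrow.mk h

/-- The theory formed by the natural transformations between functors `X^n ⥤ X`. -/
def endMor : Theory.{max u v} where
  W n := Arrow ((Fin n → X) ⥤ X)
  map f α := Arrow.mk (Functor.whiskerLeft (reindex X f) α.hom)
  one := Arrow.mk (𝟙 (Pi.eval (fun _ : Fin 1 => X) 0))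
  γ α β := Arrow.mk (plugMap α.hom fun i => (β i).hom)
  map_id α := rfl
  map_map g f α := rfl
  γ_assoc F G H := plugMap_assoc X F G H
  γ_one {k} F := by
    have h : (fun i : Fin k => (unblk (n := fun _ : Fin k => 1) (blk i 0)).1) = fun i => i :=
      funext fun i => by rw [unblk_blk]
    exact (plugMap_one X _ F).trans
      (congrArg (fun c : Fin k → Fin k => Arrow.mk (Functor.whiskerLeft (reindex X c) F.hom)) h)
  one_γ {n} F := by
    have h : (fun j : Fin n => (unblk (n := fun _ : Fin 1 => n) (blk 0 j)).2) = fun j => j :=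
      funext fun j => by rw [unblk_blk]
    exact (one_plugMap X _ F).trans
      (congrArg (fun c : Fin n → Fin n => Arrow.mk (Functor.whiskerLeft (reindex X c) F.hom)) h)
  γ_map_left {k l n} f F G := congrArg
    (fun c : ∀ i, Fin (n (f i)) → Fin (∑ i, n i) => Arrow.mk
      (tupleMap (fun i => Functor.whiskerLeft (reindex X (c i)) (G (f i)).hom) ◫ F.hom))
    (a₁ := fun i j => blk (f i) j)
    (a₂ := fun i j => moveBlocks f (blk (n := fun i => n (f i)) i j))
    (funext fun i => funext fun j => (moveBlocks_blk f i j).symm)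
  γ_map_right {k n n'} g F G := congrArg
    (fun c : ∀ i, Fin (n i) → Fin (∑ i, n' i) => Arrow.mk
      (tupleMap (fun i => Functor.whiskerLeft (reindex X (c i)) (G i).hom) ◫ F.hom))
    (a₁ := fun i j => blk i (g i j)) (a₂ := fun i j => sumMap g (blk i j))
    (funext fun i => funext fun j => (sumMap_blk g i j).symm)

/-- Composition of composable arrows of a category. -/
abbrev arrowComp {D : Type u} [Category.{v} D] (f g : Arrow D) (h : f.right = g.left) : Arrow D :=
  Arrow.mk (f.hom ≫ eqToHom h ≫ g.hom)

theorem mk_eqToHom_comp {D : Type u} [Category.{v} D] {a : D} (g : Arrow D) (h : a = g.left) :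
    Arrow.mk (eqToHom h ≫ g.hom) = g := by
  subst h
  simp

theorem arrowComp_mk {D : Type u} [Category.{v} D] {a b c : D} (f : a ⟶ b) (g : b ⟶ c) :
    arrowComp (Arrow.mk f) (Arrow.mk g) rfl = Arrow.mk (f ≫ g) := by
  simp [arrowComp]

/-- The endomorphism categorical theory of the category `X`: it consists of the functors
`X^n ⥤ X` and the natural transformations between them. -/
def endTheory : CatTheory.{max u v} where
  Obj := endObj X
  Mor := endMor X
  src :=
    { app := fun {n} (α : Arrow ((Fin n → X) ⥤ X)) => α.left
      app_map := fun _ _ => rfl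
      app_one := rfl
      app_γ := fun _ _ => rfl }
  tgt :=
    { app := fun {n} (α : Arrow ((Fin n → X) ⥤ X)) => α.right
      app_map := fun _ _ => rfl
      app_one := rfl
      app_γ := fun _ _ => rfl }
  idn :=
    { app := fun {n} (F : (Fin n → X) ⥤ X) => Arrow.mk (𝟙 F)
      app_map := fun _ _ => rfl
      app_one := rfl
      app_γ := fun {k n} (F : (Fin k → X) ⥤ X) (G : ∀ i, (Fin (n i) → X) ⥤ X) => by
        have h : 𝟙 (plug F G) = plugMap (𝟙 F) fun i => 𝟙 (G i) := by
          ext x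
          exact ((Category.id_comp _).trans (F.map_id _)).symm
        exact congrArg Arrow.mk h }
  comp {n} (f g : Arrow ((Fin n → X) ⥤ X)) h := arrowComp f g h
  src_idn F := rfl
  tgt_idn F := rfl
  src_comp f g h := rfl
  tgt_comp f g h := rfl
  idn_comp {n} (f : Arrow ((Fin n → X) ⥤ X)) :=
    (arrowComp_mk (𝟙 f.left) f.hom).trans (congrArg Arrow.mk (Category.id_comp _))
  comp_idn {n} (f : Arrow ((Fin n → X) ⥤ X)) :=
    (arrowComp_mk f.hom (𝟙 f.right)).trans (congrArg Arrow.mk (Category.comp_id _))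
  comp_assoc {n} (f g k : Arrow ((Fin n → X) ⥤ X)) h h' := by
    refine congrArg Arrow.mk ?_
    simp only [Arrow.mk_hom, Category.assoc]
  map_comp {m n} φ (f g : Arrow ((Fin m → X) ⥤ X)) (h : f.right = g.left) := by
    obtain ⟨F, G, f⟩ := f
    obtain ⟨G', K, g⟩ := g
    change G = G' at h
    subst h
    change F ⟶ G at f
    change G ⟶ K at g
    have e : Functor.whiskerLeft (reindex X φ) (f ≫ g) =
        Functor.whiskerLeft (reindex X φ) f ≫ Functor.whiskerLeft (reindex X φ) g := rfl
    exact (congrArg ((endMor X).map φ) (arrowComp_mk f g)).trans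
      ((congrArg Arrow.mk e).trans (arrowComp_mk _ _).symm)
  γ_comp {k n} (f g : Arrow ((Fin k → X) ⥤ X)) (h : f.right = g.left)
      (p q : ∀ i, Arrow ((Fin (n i) → X) ⥤ X)) (h' : ∀ i, (p i).right = (q i).left) := by
    obtain ⟨F, G, f⟩ := f
    obtain ⟨G', K, g⟩ := g
    change G = G' at h
    subst h
    change F ⟶ G at f
    change G ⟶ K at g
    obtain ⟨P, Q, R, β, δ, rfl, rfl⟩ : ∃ (P Q R : ∀ i, (Fin (n i) → X) ⥤ X)
        (β : ∀ i, P i ⟶ Q i) (δ : ∀ i, Q i ⟶ R i),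
        p = (fun i => Arrow.mk (β i)) ∧ q = fun i => Arrow.mk (δ i) :=
      ⟨fun i => (p i).left, fun i => (p i).right, fun i => (q i).right, fun i => (p i).hom,
        fun i => eqToHom (h' i) ≫ (q i).hom, rfl,
        funext fun i => (mk_eqToHom_comp (q i) (h' i)).symm⟩
    have e : plugMap (f ≫ g) (fun i => β i ≫ δ i) = plugMap f β ≫ plugMap g δ := by
      ext x
      let y : Fin k → X := fun i => (P i).obj fun j => x (blk i j)
      let b : y ⟶ fun i => (Q i).obj fun j => x (blk i j) := fun i => (β i).app _
      let d : (fun i => (Q i).obj fun j => x (blk i j)) ⟶ fun i => (R i).obj fun j => x (blk i j) :=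
        fun i => (δ i).app _
      change (f.app y ≫ g.app y) ≫ K.map (b ≫ d) =
        (f.app y ≫ G.map b) ≫ g.app _ ≫ K.map d
      simp
    have e1 : (fun i => arrowComp (Arrow.mk (β i)) (Arrow.mk (δ i)) rfl) =
        fun i => Arrow.mk (β i ≫ δ i) := funext fun i => arrowComp_mk (β i) (δ i)
    exact (congrArg₂ ((endMor X).γ) (arrowComp_mk f g) e1).trans
      ((congrArg Arrow.mk e).trans (arrowComp_mk _ _).symm)

end End

section LaplazaSet

/-- A Laplaza set for `T`: an arbitrary collection of sets of words of `T`. -/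
abbrev LaplazaSet (T : Theory.{u}) := ∀ n, Set (T.W n)

variable {T : Theory.{u}} (S : LaplazaSet T)

/-- The object theory of `T'_S`: the free theory on the collection `S`. -/
abbrev LaplazaSet.words : Theory.{u} := freeTheory fun n => S n

/-- The projection of the free theory on the collection `S` to `T`. -/
abbrev LaplazaSet.proj : TheoryHom S.words T := freeTheoryLift fun z => z.1

/-- Formal morphisms of `T'_S`: everything that can be written, with the operations of a
categorical theory, in terms of one generator `ι a b` for each pair of words `a`, `b` that project
to the same element of `S`. (The unit of the theory of morphisms is the identity of the unit.) -/
inductive PreMor : (n : ℕ) → S.words.W n → S.words.W n → Type u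
  | ι {n : ℕ} (a b : S.words.W n) (h : S.proj.app a = S.proj.app b)
      (hS : S.proj.app a ∈ S n) : PreMor n a b
  | idn {n : ℕ} (a : S.words.W n) : PreMor n a a
  | comp {n : ℕ} {a b c : S.words.W n} : PreMor n a b → PreMor n b c → PreMor n a c
  | map {m n : ℕ} (f : Fin m → Fin n) {a b : S.words.W m} :
      PreMor m a b → PreMor n (S.words.map f a) (S.words.map f b)
  | γ {k : ℕ} {n : Fin k → ℕ} {a b : S.words.W k} {a' b' : ∀ i, S.words.W (n i)} :
      PreMor k a b → (∀ i, PreMor (n i) (a' i) (b' i)) →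
        PreMor (∑ i, n i) (S.words.γ a a') (S.words.γ b b')

variable {S}

/-- The smallest equivalence relation on the formal morphisms that is preserved by the operations,
contains the axioms of a categorical theory, and contains the relations of `T'_S`. -/
inductive PreMor.Rel : ∀ {n : ℕ} {a b c d : S.words.W n}, PreMor S n a b → PreMor S n c d → Prop
  -- equivalence relation
  | refl {n : ℕ} {a b : S.words.W n} (α : PreMor S n a b) : Rel α α
  | symm {n : ℕ} {a b c d : S.words.W n} {α : PreMor S n a b} {β : PreMor S n c d} :
      Rel α β → Rel β α
  | trans {n : ℕ} {a b c d e f : S.words.W n} {α : PreMor S n a b} {β : PreMor S n c d}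
      {δ : PreMor S n e f} : Rel α β → Rel β δ → Rel α δ
  -- compatibility with the operations
  | comp_congr {n : ℕ} {a b c a' b' c' : S.words.W n} {α : PreMor S n a b} {β : PreMor S n b c}
      {α' : PreMor S n a' b'} {β' : PreMor S n b' c'} :
      Rel α α' → Rel β β' → Rel (α.comp β) (α'.comp β')
  | map_congr {m n : ℕ} (f : Fin m → Fin n) {a b c d : S.words.W m} {α : PreMor S m a b}
      {β : PreMor S m c d} : Rel α β → Rel (α.map f) (β.map f)
  | γ_congr {k : ℕ} {n : Fin k → ℕ} {a b c d : S.words.W k} {a' b' c' d' : ∀ i, S.words.W (n i)}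
      {α : PreMor S k a b} {β : PreMor S k c d} {α' : ∀ i, PreMor S (n i) (a' i) (b' i)}
      {β' : ∀ i, PreMor S (n i) (c' i) (d' i)} :
      Rel α β → (∀ i, Rel (α' i) (β' i)) → Rel (α.γ α') (β.γ β')
  -- the axioms of a category
  | idn_comp {n : ℕ} {a b : S.words.W n} (α : PreMor S n a b) : Rel ((idn a).comp α) α
  | comp_idn {n : ℕ} {a b : S.words.W n} (α : PreMor S n a b) : Rel (α.comp (idn b)) α
  | comp_assoc {n : ℕ} {a b c d : S.words.W n} (α : PreMor S n a b) (β : PreMor S n b c)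
      (δ : PreMor S n c d) : Rel ((α.comp β).comp δ) (α.comp (β.comp δ))
  -- the axioms of a theory
  | map_id {n : ℕ} {a b : S.words.W n} (α : PreMor S n a b) : Rel (α.map id) α
  | map_map {l m n : ℕ} (g : Fin m → Fin n) (f : Fin l → Fin m) {a b : S.words.W l}
      (α : PreMor S l a b) : Rel ((α.map f).map g) (α.map (g ∘ f))
  | γ_assoc {k : ℕ} {n : Fin k → ℕ} {l : ∀ i, Fin (n i) → ℕ} {a b : S.words.W k}
      {a' b' : ∀ i, S.words.W (n i)} {a'' b'' : ∀ i j, S.words.W (l i j)} (α : PreMor S k a b)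
      (β : ∀ i, PreMor S (n i) (a' i) (b' i))
      (δ : ∀ i j, PreMor S (l i j) (a'' i j) (b'' i j)) :
      Rel (α.γ fun i => (β i).γ (δ i))
        (((α.γ β).γ (n := flat l) fun p => δ (unblk p).1 (unblk p).2).map (regroup l))
  | γ_one {k : ℕ} {a b : S.words.W k} (α : PreMor S k a b) :
      Rel ((α.γ fun _ => idn S.words.one).map (fun p => (unblk p).1)) α
  | one_γ {n : ℕ} {a b : S.words.W n} (α : PreMor S n a b) :
      Rel (((idn S.words.one).γ fun _ : Fin 1 => α).map
        (fun p => (unblk (n := fun _ : Fin 1 => n) p).2)) α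
  | γ_map_left {k l : ℕ} {n : Fin l → ℕ} (f : Fin k → Fin l) {a b : S.words.W k}
      {a' b' : ∀ i, S.words.W (n i)} (α : PreMor S k a b)
      (β : ∀ i, PreMor S (n i) (a' i) (b' i)) :
      Rel ((α.map f).γ β) ((α.γ fun i => β (f i)).map (moveBlocks f))
  | γ_map_right {k : ℕ} {n n' : Fin k → ℕ} (g : ∀ i, Fin (n i) → Fin (n' i)) {a b : S.words.W k}
      {a' b' : ∀ i, S.words.W (n i)} (α : PreMor S k a b)
      (β : ∀ i, PreMor S (n i) (a' i) (b' i)) :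
      Rel (α.γ fun i => (β i).map (g i)) ((α.γ β).map (sumMap g))
  -- the identities form a morphism of theories
  | map_idn {m n : ℕ} (f : Fin m → Fin n) (a : S.words.W m) :
      Rel ((idn a).map f) (idn (S.words.map f a))
  | γ_idn {k : ℕ} {n : Fin k → ℕ} (a : S.words.W k) (a' : ∀ i, S.words.W (n i)) :
      Rel ((idn a).γ fun i => idn (a' i)) (idn (S.words.γ a a'))
  -- composition is a morphism of theories
  | map_comp {m n : ℕ} (f : Fin m → Fin n) {a b c : S.words.W m} (α : PreMor S m a b)
      (β : PreMor S m b c) : Rel ((α.comp β).map f) ((α.map f).comp (β.map f))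
  | γ_comp {k : ℕ} {n : Fin k → ℕ} {a b c : S.words.W k} {a' b' c' : ∀ i, S.words.W (n i)}
      (α : PreMor S k a b) (β : PreMor S k b c) (α' : ∀ i, PreMor S (n i) (a' i) (b' i))
      (β' : ∀ i, PreMor S (n i) (b' i) (c' i)) :
      Rel ((α.comp β).γ fun i => (α' i).comp (β' i)) ((α.γ α').comp (β.γ β'))
  -- the generator from `a` to `a` is the identity
  | ι_self {n : ℕ} (a : S.words.W n) (h : S.proj.app a = S.proj.app a) (hS : S.proj.app a ∈ S n) :
      Rel (ι a a h hS) (idn a)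
  -- the generators `ι a b` and `ι b a` are inverse to each other
  | ι_inv {n : ℕ} (a b : S.words.W n) (h : S.proj.app a = S.proj.app b)
      (h' : S.proj.app b = S.proj.app a) (hS : S.proj.app a ∈ S n) (hS' : S.proj.app b ∈ S n) :
      Rel ((ι a b h hS).comp (ι b a h' hS')) (idn a)
  -- parallel morphisms agree if source and target project to the same element of `S`
  | parallel {n : ℕ} {a b : S.words.W n} (α β : PreMor S n a b)
      (h : S.proj.app a = S.proj.app b) (hS : S.proj.app a ∈ S n) : Rel α β

theorem PreMor.Rel.ends {n : ℕ} {a b c d : S.words.W n} {α : PreMor S n a b} {β : PreMor S n c d}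
    (h : PreMor.Rel α β) : a = c ∧ b = d := by
  induction h with
  | refl α => exact ⟨rfl, rfl⟩
  | symm _ ih => exact ⟨ih.1.symm, ih.2.symm⟩
  | trans _ _ ih ih' => exact ⟨ih.1.trans ih'.1, ih.2.trans ih'.2⟩
  | comp_congr _ _ ih ih' => exact ⟨ih.1, ih'.2⟩
  | map_congr f _ ih => exact ⟨by rw [ih.1], by rw [ih.2]⟩
  | γ_congr _ _ ih ih' =>
    exact ⟨congrArg₂ _ ih.1 (funext fun i => (ih' i).1), congrArg₂ _ ih.2 (funext fun i => (ih' i).2)⟩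
  | idn_comp | comp_idn | comp_assoc | map_comp | γ_comp | ι_self | ι_inv | parallel | map_idn |
    γ_idn => exact ⟨rfl, rfl⟩
  | map_id => exact ⟨S.words.map_id _, S.words.map_id _⟩
  | map_map => exact ⟨S.words.map_map _ _ _, S.words.map_map _ _ _⟩
  | γ_assoc => exact ⟨S.words.γ_assoc _ _ _, S.words.γ_assoc _ _ _⟩
  | γ_one => exact ⟨S.words.γ_one _, S.words.γ_one _⟩
  | one_γ => exact ⟨S.words.one_γ _, S.words.one_γ _⟩
  | γ_map_left => exact ⟨S.words.γ_map_left _ _ _, S.words.γ_map_left _ _ _⟩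
  | γ_map_right => exact ⟨S.words.γ_map_right _ _ _, S.words.γ_map_right _ _ _⟩

/-- In `T'_S`, the source and the target of a morphism project to the same word of `T`. -/
theorem PreMor.proj_eq {n : ℕ} {a b : S.words.W n} (α : PreMor S n a b) :
    S.proj.app a = S.proj.app b := by
  induction α with
  | ι a b h _ => exact h
  | idn a => rfl
  | comp _ _ ih ih' => exact ih.trans ih'
  | map f _ ih => rw [S.proj.app_map, S.proj.app_map, ih]
  | γ _ _ ih ih' => rw [S.proj.app_γ, S.proj.app_γ, ih]; simp only [ih']

variable (S)

/-- The formal morphisms, with all sources and targets. -/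
abbrev Formal (n : ℕ) : Type u := (a : S.words.W n) × (b : S.words.W n) × PreMor S n a b

/-- Equality of formal morphisms in `T'_S`. -/
instance formalSetoid (n : ℕ) : Setoid (Formal S n) where
  r x y := PreMor.Rel x.2.2 y.2.2
  iseqv := ⟨fun x => .refl x.2.2, .symm, .trans⟩

/-- The morphisms of `T'_S`. -/
abbrev LapMor (n : ℕ) : Type u := Quotient (formalSetoid S n)

variable {S}

/-- The class of a formal morphism. -/
def PreMor.cls {n : ℕ} {a b : S.words.W n} (α : PreMor S n a b) : LapMor S n :=
  Quotient.mk _ ⟨a, b, α⟩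

theorem PreMor.cls_eq {n : ℕ} {a b c d : S.words.W n} {α : PreMor S n a b} {β : PreMor S n c d}
    (h : PreMor.Rel α β) : α.cls = β.cls := Quotient.sound h

namespace LapMor

/-- The source of a morphism. -/
def src {n : ℕ} (x : LapMor S n) : S.words.W n :=
  Quotient.lift (fun x : Formal S n => x.1) (fun _ _ h => (PreMor.Rel.ends h).1) x

/-- The target of a morphism. -/
def tgt {n : ℕ} (x : LapMor S n) : S.words.W n :=
  Quotient.lift (fun x : Formal S n => x.2.1) (fun _ _ h => (PreMor.Rel.ends h).2) x

/-- A representative of a morphism. -/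
noncomputable def rep {n : ℕ} (x : LapMor S n) : PreMor S n x.src x.tgt :=
  have h : x.out.1 = x.src ∧ x.out.2.1 = x.tgt := by
    have e := Quotient.out_eq x
    exact ⟨congrArg src e, congrArg tgt e⟩
  h.1 ▸ h.2 ▸ x.out.2.2

theorem cls_rep {n : ℕ} (x : LapMor S n) : x.rep.cls = x := by
  have key : ∀ (z : Formal S n) (a b : S.words.W n) (h : z.1 = a ∧ z.2.1 = b),
      PreMor.cls (h.1 ▸ h.2 ▸ z.2.2 : PreMor S n a b) = Quotient.mk _ z := by
    rintro ⟨a, b, α⟩ _ _ ⟨rfl, rfl⟩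
    rfl
  exact (key x.out _ _ ⟨congrArg src (Quotient.out_eq x), congrArg tgt (Quotient.out_eq x)⟩).trans
    (Quotient.out_eq x)

theorem rep_cls {n : ℕ} {a b : S.words.W n} (α : PreMor S n a b) : PreMor.Rel α.cls.rep α :=
  Quotient.exact (cls_rep α.cls)

/-- Composition of morphisms. -/
noncomputable def comp {n : ℕ} (x y : LapMor S n) (h : x.tgt = y.src) : LapMor S n :=
  (PreMor.comp (b := y.src) (h ▸ x.rep) y.rep).cls

/-- Renaming of variables in morphisms. -/
noncomputable def map {m n : ℕ} (f : Fin m → Fin n) (x : LapMor S m) : LapMor S n :=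
  (x.rep.map f).cls

/-- Substitution of morphisms into morphisms. -/
noncomputable def γ {k : ℕ} {n : Fin k → ℕ} (x : LapMor S k) (y : ∀ i, LapMor S (n i)) :
    LapMor S (∑ i, n i) :=
  (x.rep.γ fun i => (y i).rep).cls

theorem comp_cls {n : ℕ} {a b c : S.words.W n} (α : PreMor S n a b) (β : PreMor S n b c) :
    comp α.cls β.cls rfl = (α.comp β).cls :=
  PreMor.cls_eq (.comp_congr (rep_cls α) (rep_cls β))

theorem map_cls {m n : ℕ} (f : Fin m → Fin n) {a b : S.words.W m} (α : PreMor S m a b) :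
    map f α.cls = (α.map f).cls :=
  PreMor.cls_eq (.map_congr f (rep_cls α))

theorem γ_cls {k : ℕ} {n : Fin k → ℕ} {a b : S.words.W k} {a' b' : ∀ i, S.words.W (n i)}
    (α : PreMor S k a b) (β : ∀ i, PreMor S (n i) (a' i) (b' i)) :
    γ α.cls (fun i => (β i).cls) = (α.γ β).cls :=
  PreMor.cls_eq (.γ_congr (rep_cls α) fun i => rep_cls (β i))

theorem exists_cls {n : ℕ} (x : LapMor S n) :
    ∃ (a b : S.words.W n) (α : PreMor S n a b), x = α.cls :=
  ⟨_, _, x.rep, (cls_rep x).symm⟩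

theorem exists_cls_family {k : ℕ} {n : Fin k → ℕ} (x : ∀ i, LapMor S (n i)) :
    ∃ (a b : ∀ i, S.words.W (n i)) (α : ∀ i, PreMor S (n i) (a i) (b i)),
      x = fun i => (α i).cls :=
  ⟨_, _, fun i => (x i).rep, funext fun i => (cls_rep (x i)).symm⟩

theorem exists_cls_comp {n : ℕ} (x y : LapMor S n) (h : x.tgt = y.src) :
    ∃ (a b c : S.words.W n) (α : PreMor S n a b) (β : PreMor S n b c), x = α.cls ∧ y = β.cls := by
  obtain ⟨a, b, α, rfl⟩ := exists_cls x
  obtain ⟨b', c, β, rfl⟩ := exists_cls y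
  change b = b' at h
  subst h
  exact ⟨a, b, c, α, β, rfl, rfl⟩

end LapMor

variable (S)

/-- The theory formed by the morphisms of `T'_S`. -/
noncomputable def lapMorTheory : Theory.{u} where
  W n := LapMor S n
  map f x := LapMor.map f x
  one := (PreMor.idn S.words.one).cls
  γ x y := LapMor.γ x y
  map_id x := by
    obtain ⟨a, b, α, rfl⟩ := LapMor.exists_cls x
    rw [LapMor.map_cls]
    exact PreMor.cls_eq (.map_id α)
  map_map g f x := by
    obtain ⟨a, b, α, rfl⟩ := LapMor.exists_cls x
    rw [LapMor.map_cls, LapMor.map_cls, LapMor.map_cls]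
    exact PreMor.cls_eq (.map_map g f α)
  γ_assoc {k n l} x y z := by
    obtain ⟨a, b, α, rfl⟩ := LapMor.exists_cls x
    obtain ⟨a', b', β, rfl⟩ := LapMor.exists_cls_family y
    obtain ⟨a'', b'', δ, rfl⟩ : ∃ (a'' b'' : ∀ i j, S.words.W (l i j))
        (δ : ∀ i j, PreMor S (l i j) (a'' i j) (b'' i j)), z = fun i j => (δ i j).cls :=
      ⟨_, _, fun i j => (z i j).rep, funext fun i => funext fun j => (LapMor.cls_rep _).symm⟩
    have e : (fun i => LapMor.γ (β i).cls fun j => (δ i j).cls) =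
        fun i => ((β i).γ (δ i)).cls := funext fun i => LapMor.γ_cls _ _
    have e' := LapMor.γ_cls (n := flat l) (α.γ β) fun p => δ (unblk p).1 (unblk p).2
    rw [e, LapMor.γ_cls, LapMor.γ_cls, e', LapMor.map_cls]
    exact PreMor.cls_eq (.γ_assoc α β δ)
  γ_one x := by
    obtain ⟨a, b, α, rfl⟩ := LapMor.exists_cls x
    rw [LapMor.γ_cls, LapMor.map_cls]
    exact PreMor.cls_eq (.γ_one α)
  one_γ x := by
    obtain ⟨a, b, α, rfl⟩ := LapMor.exists_cls x
    rw [LapMor.γ_cls, LapMor.map_cls]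
    exact PreMor.cls_eq (.one_γ α)
  γ_map_left f x y := by
    obtain ⟨a, b, α, rfl⟩ := LapMor.exists_cls x
    obtain ⟨a', b', β, rfl⟩ := LapMor.exists_cls_family y
    rw [LapMor.map_cls, LapMor.γ_cls, LapMor.γ_cls, LapMor.map_cls]
    exact PreMor.cls_eq (.γ_map_left f α β)
  γ_map_right g x y := by
    obtain ⟨a, b, α, rfl⟩ := LapMor.exists_cls x
    obtain ⟨a', b', β, rfl⟩ := LapMor.exists_cls_family y
    simp only [LapMor.map_cls, LapMor.γ_cls]
    exact PreMor.cls_eq (.γ_map_right g α β)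

/-- The categorical theory `T'_S`. -/
noncomputable def laplazaTheory : CatTheory.{u} where
  Obj := S.words
  Mor := lapMorTheory S
  src :=
    { app := fun {n} (x : LapMor S n) => x.src
      app_map := fun _ (x : LapMor S _) => rfl
      app_one := rfl
      app_γ := fun _ _ => rfl }
  tgt :=
    { app := fun {n} (x : LapMor S n) => x.tgt
      app_map := fun _ (x : LapMor S _) => rfl
      app_one := rfl
      app_γ := fun _ _ => rfl }
  idn :=
    { app := fun a => (PreMor.idn a).cls
      app_map := fun f a => ((LapMor.map_cls f _).trans (PreMor.cls_eq (.map_idn f a))).symm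
      app_one := rfl
      app_γ := fun a a' => ((LapMor.γ_cls _ _).trans (PreMor.cls_eq (.γ_idn a a'))).symm }
  comp x y h := LapMor.comp x y h
  src_idn _ := rfl
  tgt_idn _ := rfl
  src_comp {n} (x y : LapMor S n) (h : x.tgt = y.src) := by
    obtain ⟨a, b, c, α, β, rfl, rfl⟩ := LapMor.exists_cls_comp x y h
    rw [LapMor.comp_cls]
    rfl
  tgt_comp {n} (x y : LapMor S n) (h : x.tgt = y.src) := by
    obtain ⟨a, b, c, α, β, rfl, rfl⟩ := LapMor.exists_cls_comp x y h
    rw [LapMor.comp_cls]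
    rfl
  idn_comp {n} (x : LapMor S n) := by
    obtain ⟨a, b, α, rfl⟩ := LapMor.exists_cls x
    exact (LapMor.comp_cls _ α).trans (PreMor.cls_eq (.idn_comp α))
  comp_idn {n} (x : LapMor S n) := by
    obtain ⟨a, b, α, rfl⟩ := LapMor.exists_cls x
    exact (LapMor.comp_cls α _).trans (PreMor.cls_eq (.comp_idn α))
  comp_assoc {n} (x y z : LapMor S n) (h : x.tgt = y.src) (h' : y.tgt = z.src) := by
    obtain ⟨a, b, c, α, β, rfl, rfl⟩ := LapMor.exists_cls_comp x y h
    obtain ⟨c', d, δ, rfl⟩ := LapMor.exists_cls z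
    change c = c' at h'
    subst h'
    simp only [LapMor.comp_cls]
    exact PreMor.cls_eq (.comp_assoc α β δ)
  map_comp {m n} f (x y : LapMor S m) (h : x.tgt = y.src) := by
    obtain ⟨a, b, c, α, β, rfl, rfl⟩ := LapMor.exists_cls_comp x y h
    change LapMor.map f (LapMor.comp _ _ rfl) = LapMor.comp (LapMor.map f _) (LapMor.map f _) _
    simp only [LapMor.comp_cls, LapMor.map_cls]
    exact PreMor.cls_eq (.map_comp f α β)
  γ_comp {k n} (x y : LapMor S k) (h : x.tgt = y.src) (p q : ∀ i, LapMor S (n i))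
      (h' : ∀ i, (p i).tgt = (q i).src) := by
    obtain ⟨a, b, c, α, β, rfl, rfl⟩ := LapMor.exists_cls_comp x y h
    choose a' b' c' α' β' hp hq using fun i => LapMor.exists_cls_comp (p i) (q i) (h' i)
    obtain rfl : p = fun i => (α' i).cls := funext hp
    obtain rfl : q = fun i => (β' i).cls := funext hq
    change LapMor.γ (LapMor.comp _ _ rfl) (fun i => LapMor.comp _ _ rfl) =
      LapMor.comp (LapMor.γ _ _) (LapMor.γ _ _) _
    simp only [LapMor.comp_cls, LapMor.γ_cls]
    exact PreMor.cls_eq (.γ_comp α β α' β')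

/-- The projection of `T'_S` to `T`, considered as a categorical theory with identity
morphisms only. -/
noncomputable def laplazaProj : CatTheoryHom (laplazaTheory S) (discreteTheory T) where
  obj := S.proj
  mor := (laplazaTheory S).src.trans S.proj
  src_mor _ := rfl
  tgt_mor {n} (x : LapMor S n) := by
    obtain ⟨a, b, α, rfl⟩ := LapMor.exists_cls x
    exact α.proj_eq
  mor_idn _ := rfl
  mor_comp x y h := by
    change S.proj.app ((laplazaTheory S).src.app _) = _
    rw [(laplazaTheory S).src_comp]
    rfl

end LaplazaSet

/-- Algebras over a categorical theory `C`: a category `X` with a morphism `C ⟶ End(X)`. -/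
abbrev Algebra (C : CatTheory.{w}) (X : Type u) [Category.{v} X] := CatTheoryHom C (endTheory X)

/-- Pseudo `(T,S)`-algebras. -/
abbrev PseudoAlgebra (T : Theory.{w}) (S : LaplazaSet T) (X : Type u) [Category.{v} X] :=
  Algebra (laplazaTheory S) X

/-- Strict algebras in categories over a theory `T`. -/
abbrev StrictAlgebra (T : Theory.{w}) (X : Type u) [Category.{v} X] := Algebra (discreteTheory T) X

/-- Every strict algebra is a pseudo algebra with respect to every Laplaza set. -/
noncomputable def StrictAlgebra.toPseudo {T : Theory.{w}} {X : Type u} [Category.{v} X]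
    (Φ : StrictAlgebra T X) (S : LaplazaSet T) : PseudoAlgebra T S X :=
  (laplazaProj S).trans Φ

section Morphisms

variable {C : CatTheory.{w}} {X : Type u} [Category.{v} X]

/-- The functor by which a word acts. -/
def Algebra.op (Φ : Algebra C X) {n : ℕ} (a : C.Obj.W n) : (Fin n → X) ⥤ X := Φ.obj.app a

/-- The natural transformation by which a morphism of words acts (a coherence map). -/
def Algebra.coh (Φ : Algebra C X) {n : ℕ} (α : C.Mor.W n) :
    Φ.op (C.src.app α) ⟶ Φ.op (C.tgt.app α) :=
  eqToHom (Φ.src_mor α).symm ≫ Arrow.hom (Φ.mor.app α) ≫ eqToHom (Φ.tgt_mor α)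

/-- The action of a functor of several variables on a tuple of morphisms. -/
abbrev tmap {n : ℕ} (F : (Fin n → X) ⥤ X) {x y : Fin n → X} (f : ∀ i, x i ⟶ y i) :
    F.obj x ⟶ F.obj y := F.map f

theorem Algebra.op_one (Φ : Algebra C X) (x : Fin 1 → X) : (Φ.op C.Obj.one).obj x = x 0 :=
  congrArg (fun F : (Fin 1 → X) ⥤ X => F.obj x) Φ.obj.app_one

theorem Algebra.op_map (Φ : Algebra C X) {m n : ℕ} (f : Fin m → Fin n) (a : C.Obj.W m)
    (x : Fin n → X) : (Φ.op (C.Obj.map f a)).obj x = (Φ.op a).obj fun i => x (f i) :=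
  congrArg (fun F : (Fin n → X) ⥤ X => F.obj x) (Φ.obj.app_map f a)

theorem Algebra.op_γ (Φ : Algebra C X) {k : ℕ} {n : Fin k → ℕ} (a : C.Obj.W k)
    (b : ∀ i, C.Obj.W (n i)) (x : Fin (∑ i, n i) → X) :
    (Φ.op (C.Obj.γ a b)).obj x = (Φ.op a).obj fun i => (Φ.op (b i)).obj fun j => x (blk i j) :=
  congrArg (fun F : (Fin (∑ i, n i) → X) ⥤ X => F.obj x) (Φ.obj.app_γ a b)

variable {Y : Type u} [Category.{v} Y] {Z : Type u} [Category.{v} Z]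

/-- Pseudo morphisms of algebras: a functor that commutes with the action of each word up
to a natural isomorphism, where these isomorphisms are compatible with the coherence maps
and with the unit, the renaming of variables and the composition of words. -/
structure PseudoHom (Φ : Algebra C X) (Ψ : Algebra C Y) where
  functor : X ⥤ Y
  str {n : ℕ} (a : C.Obj.W n) (x : Fin n → X) :
    functor.obj ((Φ.op a).obj x) ≅ (Ψ.op a).obj fun i => functor.obj (x i)
  str_naturality {n : ℕ} (a : C.Obj.W n) {x y : Fin n → X} (f : ∀ i, x i ⟶ y i) :
    functor.map (tmap (Φ.op a) f) ≫ (str a y).hom =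
      (str a x).hom ≫ tmap (Ψ.op a) fun i => functor.map (f i)
  str_coh {n : ℕ} (α : C.Mor.W n) (x : Fin n → X) :
    functor.map ((Φ.coh α).app x) ≫ (str (C.tgt.app α) x).hom =
      (str (C.src.app α) x).hom ≫ (Ψ.coh α).app fun i => functor.obj (x i)
  str_one (x : Fin 1 → X) :
    (str C.Obj.one x).hom =
      eqToHom (congrArg functor.obj (Φ.op_one x)) ≫ eqToHom (Ψ.op_one fun i => functor.obj (x i)).symm
  str_map {m n : ℕ} (f : Fin m → Fin n) (a : C.Obj.W m) (x : Fin n → X) :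
    (str (C.Obj.map f a) x).hom =
      eqToHom (congrArg functor.obj (Φ.op_map f a x)) ≫ (str a fun i => x (f i)).hom ≫
        eqToHom (Ψ.op_map f a fun i => functor.obj (x i)).symm
  str_γ {k : ℕ} {n : Fin k → ℕ} (a : C.Obj.W k) (b : ∀ i, C.Obj.W (n i))
    (x : Fin (∑ i, n i) → X) :
    (str (C.Obj.γ a b) x).hom =
      eqToHom (congrArg functor.obj (Φ.op_γ a b x)) ≫
        (str a fun i => (Φ.op (b i)).obj fun j => x (blk i j)).hom ≫
        tmap (Ψ.op a) (fun i => (str (b i) fun j => x (blk i j)).hom) ≫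
        eqToHom (Ψ.op_γ a b fun p => functor.obj (x p)).symm

/-- The identity pseudo morphism. -/
def PseudoHom.id (Φ : Algebra C X) : PseudoHom Φ Φ where
  functor := 𝟭 X
  str a x := Iso.refl ((Φ.op a).obj x)
  str_naturality a x y f := (Category.comp_id _).trans (Category.id_comp _).symm
  str_coh α x := (Category.comp_id _).trans (Category.id_comp _).symm
  str_one x := by simp
  str_map f a x := by simp
  str_γ a b x := by
    have h := (Φ.op a).map_id fun i => (Φ.op (b i)).obj fun j => x (blk i j)
    change 𝟙 _ = eqToHom _ ≫ 𝟙 _ ≫ (Φ.op a).map (𝟙 _) ≫ eqToHom _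
    rw [h]
    simp

/-- Composition of pseudo morphisms. -/
def PseudoHom.comp {Φ : Algebra C X} {Ψ : Algebra C Y} {Ω : Algebra C Z} (F : PseudoHom Φ Ψ)
    (G : PseudoHom Ψ Ω) : PseudoHom Φ Ω where
  functor := F.functor ⋙ G.functor
  str a x := G.functor.mapIso (F.str a x) ≪≫ G.str a fun i => F.functor.obj (x i)
  str_naturality a x y f := by
    have h := G.str_naturality a fun i => F.functor.map (f i)
    simp only [Functor.comp_map, Iso.trans_hom, Functor.mapIso_hom, Category.assoc]
    rw [← G.functor.map_comp_assoc, F.str_naturality, G.functor.map_comp_assoc, h]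
  str_coh α x := by
    have h := G.str_coh α fun i => F.functor.obj (x i)
    simp only [Functor.comp_map, Iso.trans_hom, Functor.mapIso_hom, Category.assoc]
    rw [← G.functor.map_comp_assoc, F.str_coh, G.functor.map_comp_assoc, h]
    rfl
  str_one x := by
    simp only [Iso.trans_hom, Functor.mapIso_hom, F.str_one, G.str_one, eqToHom_map,
      eqToHom_trans]
  str_map f a x := by
    simp only [Iso.trans_hom, Functor.mapIso_hom, F.str_map, G.str_map, Functor.map_comp,
      eqToHom_map, Category.assoc, eqToHom_trans_assoc, eqToHom_refl, Category.id_comp]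
  str_γ a b x := by
    have h := G.str_naturality a fun i => (F.str (b i) fun j => x (blk i j)).hom
    have h2 : tmap (Ω.op a) (fun i => G.functor.map (F.str (b i) fun j => x (blk i j)).hom ≫
        (G.str (b i) fun j => F.functor.obj (x (blk i j))).hom) =
        tmap (Ω.op a) (fun i => G.functor.map (F.str (b i) fun j => x (blk i j)).hom) ≫
        tmap (Ω.op a) (fun i => (G.str (b i) fun j => F.functor.obj (x (blk i j))).hom) :=
      (Ω.op a).map_comp (Y := fun i => G.functor.obj _) _ _
    simp only [Iso.trans_hom, Functor.mapIso_hom, F.str_γ, G.str_γ, Functor.map_comp,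
      eqToHom_map, Category.assoc, eqToHom_trans_assoc, eqToHom_refl, Category.id_comp]
    rw [reassoc_of% h, h2]
    simp only [Category.assoc]

/-- The condition that a natural transformation is a 2-cell between pseudo morphisms. -/
def IsTwoCell {Φ : Algebra C X} {Ψ : Algebra C Y} (F G : PseudoHom Φ Ψ)
    (η : F.functor ⟶ G.functor) : Prop :=
  ∀ {n : ℕ} (a : C.Obj.W n) (x : Fin n → X),
    (F.str a x).hom ≫ tmap (Ψ.op a) (fun i => η.app (x i)) =
      η.app ((Φ.op a).obj x) ≫ (G.str a x).hom

/-- Equivalences of algebras, in the 2-category of algebras, pseudo morphisms and 2-cells. -/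
structure AlgebraEquivalence (Φ : Algebra C X) (Ψ : Algebra C Y) where
  hom : PseudoHom Φ Ψ
  inv : PseudoHom Ψ Φ
  unitIso : (PseudoHom.id Φ).functor ≅ (hom.comp inv).functor
  counitIso : (inv.comp hom).functor ≅ (PseudoHom.id Ψ).functor
  unit_twoCell : IsTwoCell (PseudoHom.id Φ) (hom.comp inv) unitIso.hom
  counit_twoCell : IsTwoCell (inv.comp hom) (PseudoHom.id Ψ) counitIso.hom

end Morphisms

end Laplaza

/-!
The Laplaza set consists of all words, so in `T'_T` any two words with the same projection to the
theory of commutative monoids are joined by exactly one morphism, and it is invertible (`eq_iota`).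
In particular the symmetry of `x + x` acts as the identity in a pseudo algebra `A`. This fails in
a general symmetric monoidal category, and it is what makes the strictification possible.

A formal expression in objects of `A` (`Expr`) has a multiset of summands and a value in `A`.
Expressions with the same summands have canonically isomorphic values (`Expr.can`): after numbering
the objects that occur, so that equal objects receive the same variable, both expressions become
words with the same projection. Uniqueness of morphisms in `T'_T` implies that these isomorphisms do
not depend on the numbering (`Expr.can_eq`), are closed under composition (`Expr.can_comp`) and
under the operations (`Expr.can_op`), and agree with the coherence maps of `A` (`Expr.can_cohTo`).

The strictification (`Strict`) has as objects the finite multisets of objects of `A`, each with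
a chosen expression; its morphisms are those of `A` between the values of these expressions. The
operations on objects are sums of multisets; on morphisms they are the operations of `A`,
conjugated by canonical isomorphisms. They are strict because any word over a multiset computes its
operation (`Strict.strictOp_map_hom`), in particular a renamed or a composite word.
The functor `x ↦ {x}` and the evaluation of multisets are pseudo morphisms, inverse to each other up
to canonical isomorphisms, and all the conditions on them are equations between canonical
isomorphisms (`Strict.equivalence`).
-/

namespace Laplaza

/-! ### Substitution in theories and coherence maps of algebras -/

theorem TheoryHom.app_subst {T : Theory.{u}} {T' : Theory.{v}} (φ : TheoryHom T T') {k n : ℕ}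
    (a : T.W k) (b : Fin k → T.W n) :
    φ.app (T.subst a b) = T'.subst (φ.app a) fun i => φ.app (b i) := by
  simp only [Theory.subst, φ.app_map, φ.app_γ]

theorem freeTheory_subst {Z : ℕ → Type u} {k n : ℕ} (a : Word Z k) (s : Fin k → Word Z n) :
    (freeTheory Z).subst a s = a.subst s := by
  change (a.subst fun i => (s i).rename (blk i)).rename _ = _
  simp only [Word.rename, Word.subst_subst, Word.subst, unblk_blk, Word.subst_var]

theorem endObj_subst (X : Type u) [Category.{v} X] {k n : ℕ} (F : (Fin k → X) ⥤ X)
    (G : Fin k → (Fin n → X) ⥤ X) :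
    (endObj X).subst F G = Functor.pi' G ⋙ F :=
  congrArg (fun c : Fin k → Fin n → Fin n => Functor.pi' (fun i => reindex X (c i) ⋙ G i) ⋙ F)
    (a₁ := fun i j => (unblk (n := fun _ : Fin k => n) (blk i j)).2) (a₂ := fun _ j => j)
    (funext fun i => funext fun j => by rw [unblk_blk])

theorem endMor_subst (X : Type u) [Category.{v} X] {k n : ℕ} (α : Arrow ((Fin k → X) ⥤ X))
    (β : Fin k → Arrow ((Fin n → X) ⥤ X)) :
    (endMor X).subst α β = Arrow.mk (tupleMap (fun i => (β i).hom) ◫ α.hom) :=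
  congrArg (fun c : Fin k → Fin n → Fin n =>
      Arrow.mk (tupleMap (fun i => Functor.whiskerLeft (reindex X (c i)) (β i).hom) ◫ α.hom))
    (a₁ := fun i j => (unblk (n := fun _ : Fin k => n) (blk i j)).2) (a₂ := fun _ j => j)
    (funext fun i => funext fun j => by rw [unblk_blk])

/-- Equality of arrows is used throughout for equality of natural transformations up to `eqToHom`;
this recovers the components. -/
theorem arrow_app {J : Type w} [Category.{v} J] {X : Type u} [Category.{v} X]
    {f g : Arrow (J ⥤ X)} (h : f = g) (x : J) :
    f.hom.app x = eqToHom (by rw [h]) ≫ g.hom.app x ≫ eqToHom (by rw [h]) := by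
  subst h
  simp

theorem eqToHom_conj_conj {X : Type u} [Category.{v} X] {a a' a'' b b' b'' : X} (f : a'' ⟶ b'')
    (h : a = a') (h' : a' = a'') (k' : b'' = b') (k : b' = b) :
    eqToHom h ≫ (eqToHom h' ≫ f ≫ eqToHom k') ≫ eqToHom k =
      eqToHom (h.trans h') ≫ f ≫ eqToHom (k'.trans k) := by
  subst h h' k k'
  simp

section Algebra

variable {C : CatTheory.{w}} {X : Type u} [Category.{v} X] (Φ : Algebra C X)

/-- The action of a morphism of a categorical theory, with its source and target as they are
given by the action (rather than transported to the actions of source and target). -/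
def Algebra.arr {n : ℕ} (α : C.Mor.W n) : Arrow ((Fin n → X) ⥤ X) := Φ.mor.app α

theorem Algebra.mk_coh {n : ℕ} (α : C.Mor.W n) : Arrow.mk (Φ.coh α) = Φ.arr α := by
  have key : ∀ (f : Arrow ((Fin n → X) ⥤ X)) (F G : (Fin n → X) ⥤ X) (h : F = f.left)
      (h' : f.right = G), Arrow.mk (eqToHom h ≫ f.hom ≫ eqToHom h') = f := by
    rintro f _ _ rfl rfl
    simp
  exact key _ _ _ (Φ.src_mor α).symm (Φ.tgt_mor α)

theorem Algebra.mk_coh_idn {n : ℕ} (a : C.Obj.W n) :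
    Arrow.mk (Φ.coh (C.idn.app a)) = Arrow.mk (𝟙 (Φ.op a)) :=
  (Φ.mk_coh _).trans (Φ.mor_idn a)

theorem Algebra.mk_coh_comp {n : ℕ} (α β : C.Mor.W n) (h : C.tgt.app α = C.src.app β) :
    Arrow.mk (Φ.coh (C.comp α β h)) = Arrow.mk (Φ.coh α ≫ eqToHom (by rw [h]) ≫ Φ.coh β) := by
  have key : ∀ (f g f' g' : Arrow ((Fin n → X) ⥤ X)) (h : f.right = g.left)
      (h' : f'.right = g'.left), f = f' → g = g' → arrowComp f g h = arrowComp f' g' h' := by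
    rintro f g _ _ _ _ rfl rfl
    rfl
  exact ((Φ.mk_coh _).trans (Φ.mor_comp α β h)).trans
    (key _ _ _ _ _ _ (Φ.mk_coh α).symm (Φ.mk_coh β).symm)

theorem Algebra.mk_coh_map {m n : ℕ} (f : Fin m → Fin n) (α : C.Mor.W m) :
    Arrow.mk (Φ.coh (C.Mor.map f α)) = Arrow.mk (Functor.whiskerLeft (reindex X f) (Φ.coh α)) :=
  ((Φ.mk_coh _).trans (Φ.mor.app_map f α)).trans
    (congrArg (fun g : Arrow ((Fin m → X) ⥤ X) =>
      Arrow.mk (Functor.whiskerLeft (reindex X f) g.hom)) (Φ.mk_coh α).symm)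

theorem Algebra.mk_coh_subst {k n : ℕ} (α : C.Mor.W k) (β : Fin k → C.Mor.W n) :
    Arrow.mk (Φ.coh (C.Mor.subst α β)) =
      Arrow.mk (tupleMap (fun i => Φ.coh (β i)) ◫ Φ.coh α) :=
  ((Φ.mk_coh _).trans (Φ.mor.app_subst α β)).trans
    ((congrArg₂ (endMor X).subst (Φ.mk_coh α).symm
      (funext fun i => (Φ.mk_coh (β i)).symm)).trans (endMor_subst X _ _))

theorem Algebra.op_subst {k n : ℕ} (a : C.Obj.W k) (b : Fin k → C.Obj.W n) :
    Φ.op (C.Obj.subst a b) = Functor.pi' (fun i => Φ.op (b i)) ⋙ Φ.op a :=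
  (Φ.obj.app_subst a b).trans (endObj_subst X _ _)

theorem Algebra.op_subst_obj {k n : ℕ} (a : C.Obj.W k) (b : Fin k → C.Obj.W n) (x : Fin n → X) :
    (Φ.op (C.Obj.subst a b)).obj x = (Φ.op a).obj fun i => (Φ.op (b i)).obj x := by
  rw [Φ.op_subst]
  rfl

theorem tmap_eqToHom {k : ℕ} (F : (Fin k → X) ⥤ X) {x y : Fin k → X} (h : ∀ i, x i = y i) :
    tmap F (fun i => eqToHom (h i)) = eqToHom (by rw [funext h]) := by
  obtain rfl : x = y := funext h
  exact F.map_id x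

theorem tmap_comp {k : ℕ} (F : (Fin k → X) ⥤ X) {x y z : Fin k → X} (f : ∀ i, x i ⟶ y i)
    (g : ∀ i, y i ⟶ z i) : tmap F (fun i => f i ≫ g i) = tmap F f ≫ tmap F g :=
  F.map_comp (X := x) (Y := y) (Z := z) f g

theorem tmap_congr {k : ℕ} {F G : (Fin k → X) ⥤ X} (h : F = G) {x y : Fin k → X}
    (f : ∀ i, x i ⟶ y i) :
    tmap F f = eqToHom (by rw [h]) ≫ tmap G f ≫ eqToHom (by rw [h]) := by
  subst h
  simp

end Algebra

/-! ### Words in the theory of commutative monoids and their actions -/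

section Full

/-- The Laplaza set of all words of the theory of commutative monoids. -/
abbrev fullSet : LaplazaSet commMonoidTheory := fun _ => Set.univ

/-- The words of the theory `T'_T` in `n` variables, for the theory `T` of commutative monoids. -/
abbrev SumWord (n : ℕ) := Word (fun n => fullSet n) n

/-- The multiset of variables to which a word projects. -/
abbrev Word.content {n : ℕ} (a : SumWord n) : Multiset (Fin n) := (LaplazaSet.proj fullSet).app a

/-- The generating word with a given projection. -/
def generator {n : ℕ} (m : Multiset (Fin n)) : SumWord n :=
  Word.op (⟨m, trivial⟩ : fullSet n) Word.var

/-- The composite of words in separate variables; it is the composition `γ` of the free theory. -/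
def Word.plug {k : ℕ} {n : Fin k → ℕ} (a : SumWord k) (b : ∀ i, SumWord (n i)) :
    SumWord (∑ i, n i) :=
  a.subst fun i => (b i).rename (blk i)

theorem commMonoidTheory_subst {k n : ℕ} (a : Multiset (Fin k)) (b : Fin k → Multiset (Fin n)) :
    commMonoidTheory.subst a b = a.bind b := by
  change Multiset.map _ (a.bind fun i => (b i).map (blk i)) = _
  simp [Multiset.map_bind]

theorem Word.content_var {n : ℕ} (i : Fin n) : Word.content (Word.var i) = {i} :=
  Multiset.map_singleton _ _

theorem Word.content_subst {k n : ℕ} (a : SumWord k) (b : Fin k → SumWord n) :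
    Word.content (a.subst b) = a.content.bind fun i => (b i).content :=
  (Word.eval_subst _ b a).trans (commMonoidTheory_subst _ _)

theorem Word.content_rename {m n : ℕ} (f : Fin m → Fin n) (a : SumWord m) :
    Word.content (a.rename f) = a.content.map f :=
  (LaplazaSet.proj fullSet).app_map f a

theorem Word.content_generator {n : ℕ} (m : Multiset (Fin n)) : (generator m).content = m := by
  refine (commMonoidTheory_subst _ _).trans ?_
  change (m.bind fun i => Word.content (Word.var i)) = m
  simp only [Word.content_var]
  exact (Multiset.bind_singleton m id).trans (Multiset.map_id m)

/-- A composite of multisets, as operations of commutative monoids, is the projection of the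
composite of the generating words. -/
theorem Word.content_plug_generator {k : ℕ} {n : Fin k → ℕ} (w : Multiset (Fin k))
    (v : ∀ i, Multiset (Fin (n i))) :
    ((generator w).plug fun i => generator (v i)).content =
      w.bind fun i => (v i).map (blk i) := by
  simp only [Word.plug, Word.content_subst, Word.content_rename, Word.content_generator]

/-- The canonical isomorphism between two words with the same projection. -/
def iota {n : ℕ} (a b : SumWord n) (h : a.content = b.content) : LapMor fullSet n :=
  PreMor.cls (PreMor.ι a b h trivial)

/-- As every word belongs to the Laplaza set, morphisms of `T'_T` are determined by their ends. -/
theorem eq_iota {n : ℕ} (x : LapMor fullSet n) (a b : SumWord n) (h : a.content = b.content)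
    (ha : x.src = a) (hb : x.tgt = b) : x = iota a b h := by
  obtain ⟨a', b', α, rfl⟩ := x.exists_cls
  change a' = a at ha
  change b' = b at hb
  subst ha hb
  exact PreMor.cls_eq (.parallel _ _ h trivial)

variable {A : Type u} [Category.{v} A] (Φ : PseudoAlgebra commMonoidTheory fullSet A)

/-- The functor by which a word acts on `A`. -/
noncomputable abbrev act {n : ℕ} (a : SumWord n) : (Fin n → A) ⥤ A :=
  Algebra.op (C := laplazaTheory fullSet) Φ a

/-- The canonical natural transformation between the actions of two words with the same
projection. -/
noncomputable def cohTo {n : ℕ} (a b : SumWord n) (h : a.content = b.content) :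
    act Φ a ⟶ act Φ b :=
  Φ.coh (iota a b h)

/-- Any morphism of `T'_T` from `a` to `b` acts by `cohTo`; applied to composites, renamings and
substitutions of canonical isomorphisms, this yields the rules for computing with `cohTo`. -/
theorem mk_cohTo {n : ℕ} (a b : SumWord n) (h : a.content = b.content) (α : LapMor fullSet n)
    (ha : α.src = a) (hb : α.tgt = b) :
    Arrow.mk (cohTo Φ a b h) = Arrow.mk (Algebra.coh (C := laplazaTheory fullSet) Φ α) := by
  rw [eq_iota α a b h ha hb]
  rfl

theorem act_var {n : ℕ} (i : Fin n) (x : Fin n → A) : (act Φ (Word.var i)).obj x = x i :=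
  (Φ.op_map (fun _ : Fin 1 => i) (Word.var 0 : SumWord 1) x).trans (Φ.op_one _)

theorem act_subst {k n : ℕ} (a : SumWord k) (b : Fin k → SumWord n) (x : Fin n → A) :
    (act Φ (a.subst b)).obj x = (act Φ a).obj fun i => (act Φ (b i)).obj x := by
  rw [← Φ.op_subst_obj (C := laplazaTheory fullSet) a b x]
  exact congrArg (fun c : SumWord n => (act Φ c).obj x) (freeTheory_subst a b).symm

theorem act_rename {m n : ℕ} (f : Fin m → Fin n) (a : SumWord m) (x : Fin n → A) :
    (act Φ (a.rename f)).obj x = (act Φ a).obj fun i => x (f i) :=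
  Φ.op_map f a x

theorem act_plug {k : ℕ} {n : Fin k → ℕ} (a : SumWord k) (b : ∀ i, SumWord (n i))
    (x : Fin (∑ i, n i) → A) :
    (act Φ (a.plug b)).obj x = (act Φ a).obj fun i => (act Φ (b i)).obj fun j => x (blk i j) :=
  Φ.op_γ a b x

theorem cohTo_self {n : ℕ} (a : SumWord n) (h : a.content = a.content) :
    cohTo Φ a a h = 𝟙 _ :=
  Arrow.mk_injective _ _ ((mk_cohTo Φ a a h _ rfl rfl).trans
    (Algebra.mk_coh_idn (C := laplazaTheory fullSet) Φ a))

theorem cohTo_comp {n : ℕ} (a b c : SumWord n) (h : a.content = b.content)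
    (h' : b.content = c.content) :
    cohTo Φ a b h ≫ cohTo Φ b c h' = cohTo Φ a c (h.trans h') :=
  Arrow.mk_injective _ _ (((mk_cohTo Φ a c _ ((laplazaTheory fullSet).comp (iota a b h)
    (iota b c h') rfl) ((laplazaTheory fullSet).src_comp (iota a b h) (iota b c h') rfl)
      ((laplazaTheory fullSet).tgt_comp (iota a b h) (iota b c h') rfl)).trans
        (Algebra.mk_coh_comp (C := laplazaTheory fullSet) Φ (iota a b h) (iota b c h') rfl)).trans
          (congrArg (fun f => Arrow.mk (cohTo Φ a b h ≫ f)) (Category.id_comp _))).symm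

theorem cohTo_rename {m n : ℕ} (f : Fin m → Fin n) (a b : SumWord m) (h : a.content = b.content)
    (h' : Word.content (a.rename f) = Word.content (b.rename f)) (x : Fin n → A) :
    (cohTo Φ (a.rename f) (b.rename f) h').app x =
      eqToHom (act_rename Φ f a x) ≫ (cohTo Φ a b h).app (fun i => x (f i)) ≫
        eqToHom (act_rename Φ f b x).symm :=
  arrow_app ((mk_cohTo Φ _ _ h' ((laplazaTheory fullSet).Mor.map f (iota a b h))
    ((laplazaTheory fullSet).src.app_map f (iota a b h))
    ((laplazaTheory fullSet).tgt.app_map f (iota a b h))).trans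
      (Algebra.mk_coh_map (C := laplazaTheory fullSet) Φ f (iota a b h))) x

theorem cohTo_congr {n : ℕ} {a a' b b' : SumWord n} (ha : a = a') (hb : b = b')
    (h : a.content = b.content) (x : Fin n → A) :
    (cohTo Φ a b h).app x = eqToHom (by rw [ha]) ≫
      (cohTo Φ a' b' (by rw [← ha, ← hb, h])).app x ≫ eqToHom (by rw [hb]) := by
  subst ha hb
  simp

theorem cohTo_subst {k n : ℕ} (a b : SumWord k) (c d : Fin k → SumWord n)
    (h : a.content = b.content) (h' : ∀ i, (c i).content = (d i).content)
    (h'' : Word.content (a.subst c) = Word.content (b.subst d)) (x : Fin n → A) :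
    (cohTo Φ (a.subst c) (b.subst d) h'').app x =
      eqToHom (act_subst Φ a c x) ≫ ((cohTo Φ a b h).app (fun i => (act Φ (c i)).obj x) ≫
        tmap (act Φ b) (fun i => (cohTo Φ (c i) (d i) (h' i)).app x)) ≫
          eqToHom (act_subst Φ b d x).symm :=
  arrow_app ((mk_cohTo Φ _ _ h''
    ((laplazaTheory fullSet).Mor.subst (iota a b h) (fun i => iota (c i) (d i) (h' i)))
    (((laplazaTheory fullSet).src.app_subst (iota a b h) (fun i => iota (c i) (d i) (h' i))).trans
      (freeTheory_subst a c))
    (((laplazaTheory fullSet).tgt.app_subst (iota a b h) (fun i => iota (c i) (d i) (h' i))).trans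
      (freeTheory_subst b d))).trans (Algebra.mk_coh_subst (C := laplazaTheory fullSet) Φ
        (iota a b h) (fun i => iota (c i) (d i) (h' i)))) x

end Full

/-! ### Formal expressions and their canonical isomorphisms -/

/-- Formal expressions in the elements of `A`: words are applied to expressions, but the composites
are not carried out, so that different bracketings remain different expressions. -/
inductive Expr (A : Type u) : Type u
  | var : A → Expr A
  | op {n : ℕ} : SumWord n → (Fin n → Expr A) → Expr A

namespace Expr

section Combinatorics

variable {A : Type u}

/-- The multiset of summands of an expression. -/
def mset : Expr A → Multiset A
  | var x => {x}
  | op a t => a.content.bind fun i => (t i).mset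

/-- The elements that occur in an expression. -/
def vars : Expr A → Set A
  | var x => {x}
  | op _ t => ⋃ i, (t i).vars

theorem finite_vars (e : Expr A) : e.vars.Finite := by
  induction e with
  | var x => exact Set.finite_singleton x
  | op a t ih => exact Set.finite_iUnion ih

/-- The word obtained from an expression by replacing each element `x` of `A` by the variable `j x`. -/
def code {q : ℕ} (j : A → Fin q) : Expr A → SumWord q
  | var x => Word.var (j x)
  | op a t => a.subst fun i => (t i).code j

/-- By this equation, expressions with the same summands have codes with the same projection, for
all `j`, injective or not. -/
theorem content_code {q : ℕ} (j : A → Fin q) (e : Expr A) :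
    (e.code j).content = e.mset.map j := by
  induction e with
  | var x => exact (Word.content_var _).trans (Multiset.map_singleton _ _).symm
  | op a t ih =>
    simp only [code, mset, Multiset.map_bind, ← ih]
    exact Word.content_subst _ _

theorem code_rename {q r : ℕ} (j : A → Fin q) (j' : A → Fin r) (h : Fin q → Fin r) (e : Expr A)
    (he : ∀ x ∈ e.vars, h (j x) = j' x) : e.code j' = (e.code j).rename h := by
  induction e with
  | var x => exact congrArg Word.var (he x rfl).symm
  | op a t ih =>
    simp only [code, Word.rename, Word.subst_subst]
    congr 1
    funext i
    exact ih i fun x hx => he x (Set.mem_iUnion.2 ⟨i, hx⟩)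

/-- Every finite set of elements of `A` has a frame: an assignment `w` of elements to finitely many
variables, and a choice `j` of variables for all elements of `A` (arbitrary outside the given set)
such that `w` gives back the elements of the set. -/
theorem exists_frame {s : Set A} (hs : s.Finite) :
    ∃ (q : ℕ) (w : Fin q → A) (j : A → Fin q), ∀ x ∈ s, w (j x) = x := by
  classical
  rcases isEmpty_or_nonempty A with _ | ⟨⟨x₀⟩⟩
  -- Without elements of `A` there is no variable to choose, and none is needed.
  · exact ⟨0, Fin.elim0, isEmptyElim, fun x => isEmptyElim x⟩
  · let F := insert x₀ hs.toFinset
    refine ⟨F.card, fun p => F.equivFin.symm p, fun x => F.equivFin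
      (if h : x ∈ F then ⟨x, h⟩ else ⟨x₀, Finset.mem_insert_self _ _⟩), fun x hx => ?_⟩
    have : x ∈ F := Finset.mem_insert_of_mem (hs.mem_toFinset.2 hx)
    simp [this]

theorem content_code_eq {q : ℕ} (j : A → Fin q) {e e' : Expr A} (h : e.mset = e'.mset) :
    (e.code j).content = (e'.code j).content := by
  rw [content_code, content_code, h]

theorem mset_op_congr {k : ℕ} {a b : SumWord k} (h : a.content = b.content)
    {t t' : Fin k → Expr A} (h' : ∀ i, (t i).mset = (t' i).mset) :
    (op a t).mset = (op b t').mset := by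
  simp only [mset, h, h']

theorem mset_op_one (t : Fin 1 → Expr A) : (op (Word.var 0 : SumWord 1) t).mset = (t 0).mset := by
  simp only [mset, Word.content_var, Multiset.singleton_bind]

theorem mset_op_rename {m n : ℕ} (f : Fin m → Fin n) (a : SumWord m) (t : Fin n → Expr A) :
    (op (a.rename f) t).mset = (op a fun i => t (f i)).mset := by
  simp only [mset, Word.content_rename, Multiset.bind_map]

theorem code_op_rename {m n : ℕ} (f : Fin m → Fin n) (a : SumWord m) (t : Fin n → Expr A) {q : ℕ}
    (j : A → Fin q) : (op (a.rename f) t).code j = (op a fun i => t (f i)).code j := by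
  simp only [code, Word.rename, Word.subst_subst, Word.subst]

theorem code_plug {k : ℕ} {n : Fin k → ℕ} (a : SumWord k) (b : ∀ i, SumWord (n i))
    (t : Fin (∑ i, n i) → Expr A) {q : ℕ} (j : A → Fin q) :
    (op (a.plug b) t).code j = (op a fun i => op (b i) fun l => t (blk i l)).code j := by
  simp only [code, Word.plug, Word.rename, Word.subst_subst, Word.subst]

theorem mset_op_plug {k : ℕ} {n : Fin k → ℕ} (a : SumWord k) (b : ∀ i, SumWord (n i))
    (t : Fin (∑ i, n i) → Expr A) :
    (op (a.plug b) t).mset = (op a fun i => op (b i) fun l => t (blk i l)).mset := by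
  simp only [mset, Word.plug, Word.content_subst, Word.content_rename, Multiset.bind_assoc,
    Multiset.bind_map]

/-- An expression with given summands: a generating word, applied to a list of the summands. -/
noncomputable def rep (M : Multiset A) : Expr A :=
  op (generator (Finset.univ.val : Multiset (Fin M.toList.length))) fun i => var (M.toList.get i)

@[simp] theorem mset_rep (M : Multiset A) : (rep M).mset = M := by
  have h : Multiset.map M.toList.get Finset.univ.val = M := by
    rw [Fin.univ_val_map, List.ofFn_get, Multiset.coe_toList]
  simp only [rep, mset, Word.content_generator]
  exact (Multiset.bind_singleton _ _).trans h

end Combinatorics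

variable {A : Type u} [Category.{v} A] (Φ : PseudoAlgebra commMonoidTheory fullSet A)

/-- The value in `A` of an expression. -/
noncomputable def val : Expr A → A
  | var x => x
  | op a t => (act Φ a).obj fun i => (t i).val

theorem val_eq {q : ℕ} (w : Fin q → A) (j : A → Fin q) (e : Expr A)
    (he : ∀ x ∈ e.vars, w (j x) = x) : e.val Φ = (act Φ (e.code j)).obj w := by
  induction e with
  | var x => exact (he x rfl).symm.trans (act_var Φ _ _).symm
  | op a t ih =>
    simp only [val, code]
    refine Eq.trans ?_ (act_subst Φ _ _ _).symm
    congr 1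
    funext i
    exact ih i fun x hx => he x (Set.mem_iUnion.2 ⟨i, hx⟩)

/-- The canonical isomorphism between the values of expressions with the same summands, computed
in a frame. -/
noncomputable def canAt {q : ℕ} (w : Fin q → A) (j : A → Fin q) (e e' : Expr A)
    (he : ∀ x ∈ e.vars, w (j x) = x) (he' : ∀ x ∈ e'.vars, w (j x) = x) (h : e.mset = e'.mset) :
    e.val Φ ⟶ e'.val Φ :=
  eqToHom (val_eq Φ w j e he) ≫ (cohTo Φ (e.code j) (e'.code j) (content_code_eq j h)).app w ≫
    eqToHom (val_eq Φ w j e' he').symm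

/-- A frame can be replaced by a second one that covers all values of the first one: then the codes
in the second frame are obtained from those in the first one by renaming variables. -/
theorem canAt_refine {q r : ℕ} (w : Fin q → A) (j : A → Fin q) (w' : Fin r → A) (j' : A → Fin r)
    (hw : ∀ p, w' (j' (w p)) = w p) (e e' : Expr A)
    (he : ∀ x ∈ e.vars, w (j x) = x) (he' : ∀ x ∈ e'.vars, w (j x) = x)
    (hf : ∀ x ∈ e.vars, w' (j' x) = x) (hf' : ∀ x ∈ e'.vars, w' (j' x) = x)
    (h : e.mset = e'.mset) :
    canAt Φ w j e e' he he' h = canAt Φ w' j' e e' hf hf' h := by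
  obtain ⟨g, hg⟩ : ∃ g : Fin q → Fin r, ∀ p, g p = j' (w p) := ⟨_, fun _ => rfl⟩
  obtain rfl : (fun p => w' (g p)) = w := funext fun p => by rw [hg, hw]
  have hc : e.code j' = (e.code j).rename g :=
    code_rename j j' g e fun x hx => by rw [hg, he x hx]
  have hc' : e'.code j' = (e'.code j).rename g :=
    code_rename j j' g e' fun x hx => by rw [hg, he' x hx]
  rw [canAt, canAt, cohTo_congr Φ hc hc', cohTo_rename Φ g _ _ (content_code_eq j h)]
  simp

/-- The canonical isomorphism between the values of expressions with the same summands, computed in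
an arbitrary frame for both of them. -/
noncomputable def can (e e' : Expr A) (h : e.mset = e'.mset) : e.val Φ ⟶ e'.val Φ :=
  have H := exists_frame (e.finite_vars.union e'.finite_vars)
  canAt Φ H.choose_spec.choose H.choose_spec.choose_spec.choose e e'
    (fun x hx => H.choose_spec.choose_spec.choose_spec x (Or.inl hx))
    (fun x hx => H.choose_spec.choose_spec.choose_spec x (Or.inr hx)) h

theorem canAt_eq {q q' : ℕ} (w : Fin q → A) (j : A → Fin q) (w' : Fin q' → A) (j' : A → Fin q')
    (e e' : Expr A) (he : ∀ x ∈ e.vars, w (j x) = x) (he' : ∀ x ∈ e'.vars, w (j x) = x)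
    (hf : ∀ x ∈ e.vars, w' (j' x) = x) (hf' : ∀ x ∈ e'.vars, w' (j' x) = x)
    (h : e.mset = e'.mset) :
    canAt Φ w j e e' he he' h = canAt Φ w' j' e e' hf hf' h := by
  -- Both frames are refined by one that numbers all the elements in either of them.
  obtain ⟨r, v, i, hi⟩ := exists_frame ((Set.finite_range w).union (Set.finite_range w'))
  have hg : ∀ x ∈ e.vars, v (i x) = x := fun x hx => hi x (Or.inl ⟨j x, he x hx⟩)
  have hg' : ∀ x ∈ e'.vars, v (i x) = x := fun x hx => hi x (Or.inl ⟨j x, he' x hx⟩)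
  exact (canAt_refine Φ w j v i (fun p => hi _ (Or.inl ⟨p, rfl⟩)) e e' he he' hg hg' h).trans
    (canAt_refine Φ w' j' v i (fun p => hi _ (Or.inr ⟨p, rfl⟩)) e e' hf hf' hg hg' h).symm

/-- The canonical isomorphism does not depend on the frame. -/
theorem can_eq {q : ℕ} (w : Fin q → A) (j : A → Fin q) (e e' : Expr A)
    (he : ∀ x ∈ e.vars, w (j x) = x) (he' : ∀ x ∈ e'.vars, w (j x) = x) (h : e.mset = e'.mset) :
    can Φ e e' h = canAt Φ w j e e' he he' h := by
  unfold can
  apply canAt_eq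

/-- Expressions that give the same word in every frame have the same value, and the canonical
isomorphism between them is the identity. -/
theorem can_of_code_eq (e e' : Expr A) (h : e.mset = e'.mset) (hv : e.val Φ = e'.val Φ)
    (hc : ∀ (q : ℕ) (j : A → Fin q), e.code j = e'.code j) : can Φ e e' h = eqToHom hv := by
  obtain ⟨q, w, j, hj⟩ := exists_frame (e.finite_vars.union e'.finite_vars)
  rw [can_eq Φ w j e e' (fun x hx => hj x (Or.inl hx)) (fun x hx => hj x (Or.inr hx)) h, canAt,
    cohTo_congr Φ (hc q j) rfl, cohTo_self, NatTrans.id_app]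
  simp

@[simp] theorem can_self (e : Expr A) (h : e.mset = e.mset) : can Φ e e h = 𝟙 _ :=
  can_of_code_eq Φ e e h rfl fun _ _ => rfl

@[simp] theorem can_comp (e e' e'' : Expr A) (h : e.mset = e'.mset) (h' : e'.mset = e''.mset) :
    can Φ e e' h ≫ can Φ e' e'' h' = can Φ e e'' (h.trans h') := by
  obtain ⟨q, w, j, hj⟩ := exists_frame ((e.finite_vars.union e'.finite_vars).union e''.finite_vars)
  rw [can_eq Φ w j e e' (fun x hx => hj x (Or.inl (Or.inl hx)))
      (fun x hx => hj x (Or.inl (Or.inr hx))),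
    can_eq Φ w j e' e'' (fun x hx => hj x (Or.inl (Or.inr hx))) (fun x hx => hj x (Or.inr hx)),
    can_eq Φ w j e e'' (fun x hx => hj x (Or.inl (Or.inl hx))) (fun x hx => hj x (Or.inr hx))]
  simp only [canAt, Category.assoc, eqToHom_trans_assoc, eqToHom_refl, Category.id_comp]
  rw [← cohTo_comp Φ (e.code j) (e'.code j) (e''.code j) (content_code_eq j h)
    (content_code_eq j h'), NatTrans.comp_app, Category.assoc]

@[simp] theorem can_comp_assoc (e e' e'' : Expr A) (h : e.mset = e'.mset)
    (h' : e'.mset = e''.mset) {x : A} (f : e''.val Φ ⟶ x) :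
    can Φ e e' h ≫ can Φ e' e'' h' ≫ f = can Φ e e'' (h.trans h') ≫ f := by
  rw [← Category.assoc, can_comp]

/-- The canonical isomorphisms are compatible with the operations: changing the word and changing
its arguments can be carried out separately. -/
theorem can_op {k : ℕ} (a b : SumWord k) (h : a.content = b.content) (t t' : Fin k → Expr A)
    (h' : ∀ i, (t i).mset = (t' i).mset) (h'' : (op a t).mset = (op b t').mset) :
    can Φ (op a t) (op b t') h'' = (cohTo Φ a b h).app (fun i => (t i).val Φ) ≫
      tmap (act Φ b) (fun i => can Φ (t i) (t' i) (h' i)) := by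
  obtain ⟨q, w, j, hj⟩ := exists_frame ((op a t).finite_vars.union (op b t').finite_vars)
  have ht : ∀ i, ∀ x ∈ (t i).vars, w (j x) = x :=
    fun i x hx => hj x (Or.inl (Set.mem_iUnion.2 ⟨i, hx⟩))
  have ht' : ∀ i, ∀ x ∈ (t' i).vars, w (j x) = x :=
    fun i x hx => hj x (Or.inr (Set.mem_iUnion.2 ⟨i, hx⟩))
  have hargs : ∀ i, can Φ (t i) (t' i) (h' i) = canAt Φ w j _ _ (ht i) (ht' i) (h' i) :=
    fun i => can_eq Φ w j _ _ _ _ _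
  have hcan : can Φ (op a t) (op b t') h'' = _ :=
    can_eq Φ w j _ _ (fun x hx => hj x (Or.inl hx)) (fun x hx => hj x (Or.inr hx)) h''
  have hsubst := cohTo_subst Φ a b _ _ h (fun i => content_code_eq j (h' i))
    (content_code_eq j h'') w
  have hnat := (cohTo Φ a b h).naturality (X := fun i => (t i).val Φ)
    (Y := fun i => (act Φ ((t i).code j)).obj w) (fun i => eqToHom (val_eq Φ w j (t i) (ht i)))
  have hmap : ∀ (c : SumWord k), (act Φ c).map (X := fun i => (t i).val Φ)
    (Y := fun i => (act Φ ((t i).code j)).obj w) (fun i => eqToHom (val_eq Φ w j (t i) (ht i))) =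
      eqToHom _ := fun c => tmap_eqToHom (act Φ c) fun i => val_eq Φ w j (t i) (ht i)
  rw [hmap, hmap] at hnat
  rw [hcan]
  simp only [hargs]
  unfold canAt
  rw [tmap_comp, tmap_comp, tmap_eqToHom, tmap_eqToHom, ← reassoc_of% hnat]
  refine (congrArg (fun z => eqToHom _ ≫ z ≫ eqToHom _) hsubst).trans ?_
  refine (eqToHom_conj_conj _ _ _ _ _).trans ?_
  simp only [Category.assoc]
  rfl

/-! ### Operations on morphisms between values -/

/-- The action of a word on morphisms between the values of expressions. This is `tmap`, with the
source and the target recorded as values of expressions. -/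
noncomputable def opMap {k : ℕ} (a : SumWord k) {t t' : Fin k → Expr A}
    (f : ∀ i, (t i).val Φ ⟶ (t' i).val Φ) : (op a t).val Φ ⟶ (op a t').val Φ :=
  tmap (act Φ a) f

@[simp] theorem opMap_id {k : ℕ} (a : SumWord k) (t : Fin k → Expr A) :
    opMap Φ a (fun i => 𝟙 ((t i).val Φ)) = 𝟙 _ :=
  (act Φ a).map_id _

theorem opMap_comp {k : ℕ} (a : SumWord k) {t t' t'' : Fin k → Expr A}
    (f : ∀ i, (t i).val Φ ⟶ (t' i).val Φ) (g : ∀ i, (t' i).val Φ ⟶ (t'' i).val Φ) :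
    opMap Φ a (fun i => f i ≫ g i) = opMap Φ a f ≫ opMap Φ a g :=
  tmap_comp _ f g

theorem can_cohTo {k : ℕ} (a b : SumWord k) (h : a.content = b.content) (t : Fin k → Expr A)
    (h' : (op a t).mset = (op b t).mset) :
    can Φ (op a t) (op b t) h' = (cohTo Φ a b h).app (fun i => (t i).val Φ) := by
  refine (can_op Φ a b h t t (fun _ => rfl) h').trans ?_
  simp only [can_self]
  exact (congrArg (_ ≫ ·) ((act Φ b).map_id _)).trans (Category.comp_id _)

@[simp] theorem opMap_can {k : ℕ} (a : SumWord k) (t t' : Fin k → Expr A)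
    (h : ∀ i, (t i).mset = (t' i).mset) :
    opMap Φ a (fun i => can Φ (t i) (t' i) (h i)) =
      can Φ (op a t) (op a t') (mset_op_congr rfl h) := by
  refine Eq.symm ((can_op Φ a a rfl t t' h _).trans ?_)
  rw [cohTo_self]
  exact Category.id_comp _

theorem opMap_naturality {k : ℕ} (a b : SumWord k) (h : a.content = b.content)
    {t t' : Fin k → Expr A} (f : ∀ i, (t i).val Φ ⟶ (t' i).val Φ) :
    opMap Φ a f = can Φ (op a t) (op b t) (mset_op_congr h fun _ => rfl) ≫ opMap Φ b f ≫
      can Φ (op b t') (op a t') (mset_op_congr h.symm fun _ => rfl) := by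
  have e : opMap Φ a f ≫ can Φ (op a t') (op b t') (mset_op_congr h fun _ => rfl) =
      can Φ (op a t) (op b t) (mset_op_congr h fun _ => rfl) ≫ opMap Φ b f := by
    rw [can_cohTo Φ a b h, can_cohTo Φ a b h]
    exact (cohTo Φ a b h).naturality (X := fun i => (t i).val Φ) (Y := fun i => (t' i).val Φ) f
  rw [← Category.assoc, ← e, Category.assoc, can_comp, can_self, Category.comp_id]

theorem can_op_one (t : Fin 1 → Expr A) :
    can Φ _ _ (mset_op_one t) = eqToHom (act_var Φ 0 fun i => (t i).val Φ) :=
  can_of_code_eq Φ _ _ _ _ fun _ _ => rfl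

theorem can_op_rename {m n : ℕ} (f : Fin m → Fin n) (a : SumWord m) (t : Fin n → Expr A) :
    can Φ _ _ (mset_op_rename f a t) = eqToHom (act_rename Φ f a fun i => (t i).val Φ) :=
  can_of_code_eq Φ _ _ _ _ fun _ j => code_op_rename f a t j

theorem can_op_plug {k : ℕ} {n : Fin k → ℕ} (a : SumWord k) (b : ∀ i, SumWord (n i))
    (t : Fin (∑ i, n i) → Expr A) :
    can Φ _ _ (mset_op_plug a b t) = eqToHom (act_plug Φ a b fun i => (t i).val Φ) :=
  can_of_code_eq Φ _ _ _ _ fun _ j => code_plug a b t j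

theorem can_op_one_symm (t : Fin 1 → Expr A) :
    can Φ _ _ (mset_op_one t).symm = eqToHom (act_var Φ 0 fun i => (t i).val Φ).symm :=
  can_of_code_eq Φ _ _ _ _ fun _ _ => rfl

theorem can_op_rename_symm {m n : ℕ} (f : Fin m → Fin n) (a : SumWord m) (t : Fin n → Expr A) :
    can Φ _ _ (mset_op_rename f a t).symm = eqToHom (act_rename Φ f a fun i => (t i).val Φ).symm :=
  can_of_code_eq Φ _ _ _ _ fun _ j => (code_op_rename f a t j).symm

theorem can_op_plug_symm {k : ℕ} {n : Fin k → ℕ} (a : SumWord k) (b : ∀ i, SumWord (n i))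
    (t : Fin (∑ i, n i) → Expr A) :
    can Φ _ _ (mset_op_plug a b t).symm = eqToHom (act_plug Φ a b fun i => (t i).val Φ).symm :=
  can_of_code_eq Φ _ _ _ _ fun _ j => (code_plug a b t j).symm

theorem opMap_one {t t' : Fin 1 → Expr A} (f : ∀ i, (t i).val Φ ⟶ (t' i).val Φ) :
    opMap Φ (Word.var 0 : SumWord 1) f = can Φ _ _ (mset_op_one t) ≫ f 0 ≫
      can Φ _ _ (mset_op_one t').symm := by
  rw [can_op_one, can_op_one_symm]
  exact tmap_congr (Φ.obj.app_one) f

theorem opMap_rename {m n : ℕ} (g : Fin m → Fin n) (a : SumWord m) {t t' : Fin n → Expr A}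
    (f : ∀ i, (t i).val Φ ⟶ (t' i).val Φ) :
    opMap Φ (a.rename g) f = can Φ _ _ (mset_op_rename g a t) ≫ opMap Φ a (fun i => f (g i)) ≫
      can Φ _ _ (mset_op_rename g a t').symm := by
  rw [can_op_rename, can_op_rename_symm]
  exact tmap_congr (Φ.obj.app_map g a) f

theorem opMap_plug {k : ℕ} {n : Fin k → ℕ} (a : SumWord k) (b : ∀ i, SumWord (n i))
    {t t' : Fin (∑ i, n i) → Expr A} (f : ∀ i, (t i).val Φ ⟶ (t' i).val Φ) :
    opMap Φ (a.plug b) f = can Φ _ _ (mset_op_plug a b t) ≫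
      opMap Φ a (t := fun i => op (b i) fun l => t (blk i l))
        (t' := fun i => op (b i) fun l => t' (blk i l))
        (fun i => opMap Φ (b i) fun l => f (blk i l)) ≫
      can Φ _ _ (mset_op_plug a b t').symm := by
  rw [can_op_plug, can_op_plug_symm]
  exact tmap_congr (Φ.obj.app_γ a b) f

end Expr

/-! ### The strictification -/

section

variable {A : Type u} [Category.{v} A]

/-- The objects of the strictification of a pseudo algebra: finite multisets of objects of `A`. -/
structure Strict (Φ : PseudoAlgebra commMonoidTheory fullSet A) where
  mset : Multiset A

namespace Strict

variable {Φ : PseudoAlgebra commMonoidTheory fullSet A}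

/-- The expression that represents an object of the strictification. -/
noncomputable abbrev expr (M : Strict Φ) : Expr A := Expr.rep M.mset

/-- The morphisms of the strictification are the morphisms of `A` between the values of the
representing expressions. They form a structure, to keep them apart from morphisms of `A`. -/
@[ext] structure Hom (M N : Strict Φ) where
  hom : M.expr.val Φ ⟶ N.expr.val Φ

noncomputable instance : Category.{v} (Strict Φ) where
  Hom M N := Hom M N
  id M := ⟨𝟙 _⟩
  comp f g := ⟨f.hom ≫ g.hom⟩

@[ext] theorem hom_ext {M N : Strict Φ} {f g : M ⟶ N} (h : f.hom = g.hom) : f = g := Hom.ext h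

@[simp] theorem comp_hom {M N L : Strict Φ} (f : M ⟶ N) (g : N ⟶ L) :
    (f ≫ g).hom = f.hom ≫ g.hom := rfl

@[simp] theorem id_hom (M : Strict Φ) : (𝟙 M : M ⟶ M).hom = 𝟙 _ := rfl

/-- Since equal objects are represented by the same expression, an equality of objects acts as a
canonical isomorphism. Hence equations between functors to the strictification reduce to equations
that involve only `can`. -/
@[simp] theorem eqToHom_hom {M N : Strict Φ} (h : M = N) :
    (eqToHom h).hom = Expr.can Φ M.expr N.expr (by rw [h]) := by
  subst h
  exact (Expr.can_self Φ _ _).symm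

/-- The sum of a family of objects of the strictification. -/
def sum {n : ℕ} (w : Multiset (Fin n)) (M : Fin n → Strict Φ) : Strict Φ :=
  ⟨w.bind fun i => (M i).mset⟩

theorem mset_op {n : ℕ} {w : Multiset (Fin n)} {a : SumWord n} (h : a.content = w)
    (M : Fin n → Strict Φ) :
    (Expr.op a fun i => (M i).expr).mset = (sum w M).expr.mset := by
  simp only [Expr.mset, h, Expr.mset_rep, sum]

open Laplaza.Expr in
/-- The operation of the strictification given by a multiset `w` of variables. On morphisms it is the
action of the generating word, conjugated by canonical isomorphisms. -/
noncomputable def strictOp {n : ℕ} (w : Multiset (Fin n)) : (Fin n → Strict Φ) ⥤ Strict Φ where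
  obj M := sum w M
  map {M N} f := ⟨can Φ _ _ (mset_op (Word.content_generator w) M).symm ≫
    opMap Φ (generator w) (fun i => (f i).hom) ≫ can Φ _ _ (mset_op (Word.content_generator w) N)⟩
  map_id M := by
    ext
    simp
  map_comp f g := by
    ext
    simp [opMap_comp]

open Laplaza.Expr in
/-- The generating word in the definition of `strictOp` may be replaced by any word over the same
multiset. This makes the operations strictly compatible with renaming and composition. -/
theorem strictOp_map_hom {n : ℕ} {w : Multiset (Fin n)} {a : SumWord n} (h : a.content = w)
    {M N : Fin n → Strict Φ} (f : ∀ i, M i ⟶ N i) :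
    (tmap (strictOp w) f).hom = can Φ _ _ (mset_op h M).symm ≫
      opMap Φ a (fun i => (f i).hom) ≫ can Φ _ _ (mset_op h N) := by
  rw [opMap_naturality Φ a (generator w) (h.trans (Word.content_generator w).symm)]
  simp
  rfl

theorem functor_ext {n : ℕ} {F G : (Fin n → Strict Φ) ⥤ Strict Φ}
    (h : ∀ M, (F.obj M).expr.mset = (G.obj M).expr.mset)
    (h' : ∀ (M N : Fin n → Strict Φ) (f : ∀ i, M i ⟶ N i),
      (tmap F f).hom = Expr.can Φ _ _ (h M) ≫ (tmap G f).hom ≫ Expr.can Φ _ _ (h N).symm) :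
    F = G := by
  have e : ∀ M, F.obj M = G.obj M := fun M => by
    have := h M
    rw [Expr.mset_rep, Expr.mset_rep] at this
    exact congrArg Strict.mk this
  refine CategoryTheory.Functor.ext e fun M N f => ?_
  ext
  rw [comp_hom, comp_hom, eqToHom_hom, eqToHom_hom]
  exact h' M N f

open Laplaza.Expr in
theorem strictOp_map {m n : ℕ} (f : Fin m → Fin n) (w : Multiset (Fin m)) :
    strictOp (Φ := Φ) (w.map f) = reindex _ f ⋙ strictOp w := by
  have hw : Word.content ((generator w).rename f) = w.map f := by
    rw [Word.content_rename, Word.content_generator]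
  have h : ∀ M : Fin n → Strict Φ, (sum (w.map f) M).expr.mset =
      (sum w fun i => M (f i)).expr.mset := fun M => by
    rw [← mset_op hw M, mset_op_rename, mset_op (Word.content_generator w) fun i => M (f i)]
  refine functor_ext h fun M N g => ?_
  have e : (tmap (strictOp w) fun i => g (f i)).hom = _ :=
    strictOp_map_hom (Word.content_generator w) fun i => g (f i)
  refine (strictOp_map_hom hw g).trans (Eq.trans ?_
    (congrArg (fun z => can Φ _ _ (h M) ≫ z ≫ can Φ _ _ (h N).symm) e.symm))
  simp [opMap_rename]
  rfl

open Laplaza.Expr in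
theorem strictOp_one : strictOp (Φ := Φ) ({0} : Multiset (Fin 1)) = Pi.eval _ 0 := by
  have h : ∀ M : Fin 1 → Strict Φ, (sum {0} M).expr.mset = (M 0).expr.mset := fun M => by
    rw [← mset_op (Word.content_var 0) M, mset_op_one]
  refine functor_ext h fun M N g => ?_
  refine (strictOp_map_hom (Word.content_var 0) g).trans ?_
  rw [opMap_one]
  simp
  rfl

open Laplaza.Expr in
theorem strictOp_γ {k : ℕ} {n : Fin k → ℕ} (w : Multiset (Fin k))
    (v : ∀ i, Multiset (Fin (n i))) :
    strictOp (Φ := Φ) (w.bind fun i => (v i).map (blk i)) =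
      plug (strictOp w) fun i => strictOp (v i) := by
  have hw := Word.content_plug_generator w v
  have h : ∀ M : Fin (∑ i, n i) → Strict Φ,
      (sum (w.bind fun i => (v i).map (blk i)) M).expr.mset =
      (sum w fun i => sum (v i) fun j => M (blk i j)).expr.mset := fun M => by
    rw [← mset_op hw M, mset_op_plug,
      ← mset_op (Word.content_generator w) fun i => sum (v i) fun j => M (blk i j)]
    exact mset_op_congr rfl fun i => mset_op (Word.content_generator (v i)) fun j => M (blk i j)
  refine functor_ext h fun M N g => ?_
  have e' : ∀ i, (tmap (strictOp (v i)) fun j => g (blk i j)).hom = _ :=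
    fun i => strictOp_map_hom (Word.content_generator (v i)) fun j => g (blk i j)
  have e : (tmap (strictOp w) fun i => tmap (strictOp (v i)) fun j => g (blk i j)).hom =
      can Φ (sum w fun i => sum (v i) fun j => M (blk i j)).expr
          (op (generator w) fun i => (sum (v i) fun j => M (blk i j)).expr)
          (mset_op (Word.content_generator w) _).symm ≫
        opMap Φ (generator w) (t := fun i => (sum (v i) fun j => M (blk i j)).expr)
          (t' := fun i => (sum (v i) fun j => N (blk i j)).expr)
          (fun i => can Φ _ _ (mset_op (Word.content_generator (v i)) fun j => M (blk i j)).symm ≫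
            opMap Φ (generator (v i)) (fun j => (g (blk i j)).hom) ≫
              can Φ _ _ (mset_op (Word.content_generator (v i)) fun j => N (blk i j))) ≫
        can Φ (op (generator w) fun i => (sum (v i) fun j => N (blk i j)).expr)
          (sum w fun i => sum (v i) fun j => N (blk i j)).expr (mset_op (Word.content_generator w) _) := by
    refine (strictOp_map_hom (Word.content_generator w)
      fun i => tmap (strictOp (v i)) fun j => g (blk i j)).trans ?_
    simp only [e']
    rfl
  refine (strictOp_map_hom hw g).trans (Eq.trans ?_
    (congrArg (fun z => can Φ _ _ (h M) ≫ z ≫ can Φ _ _ (h N).symm) e.symm))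
  simp [opMap_plug, opMap_comp]
  rfl

variable (Φ) in
/-- The operations of the strictification, as a morphism of theories. -/
noncomputable def opHom : TheoryHom commMonoidTheory (endObj (Strict Φ)) where
  app {n} (w : Multiset (Fin n)) := strictOp w
  app_map := strictOp_map
  app_one := strictOp_one
  app_γ := strictOp_γ

variable (Φ) in
/-- The strict action of the theory of commutative monoids on the strictification. -/
noncomputable def algebra : StrictAlgebra commMonoidTheory (Strict Φ) where
  obj := opHom Φ
  mor := (opHom Φ).trans (endTheory (Strict Φ)).idn
  src_mor _ := rfl
  tgt_mor _ := rfl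
  mor_idn _ := rfl
  mor_comp {n} (w w' : Multiset (Fin n)) h := by
    obtain rfl : w = w' := h
    exact ((endTheory (Strict Φ)).idn_comp _).symm

end Strict

end

/-! ### Values of expressions, taken as variables -/

namespace Expr

variable {A : Type u} [Category.{v} A] (Φ : PseudoAlgebra commMonoidTheory fullSet A)

/-- The canonical isomorphism `can`, with its inverse. -/
@[simps]
noncomputable def canIso (e e' : Expr A) (h : e.mset = e'.mset) : e.val Φ ≅ e'.val Φ where
  hom := can Φ e e' h
  inv := can Φ e' e h.symm
  hom_inv_id := by simp
  inv_hom_id := by simp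

/-- A morphism of `A`, regarded as a morphism between the values of variables. -/
noncomputable def ofHom {x y : A} (f : x ⟶ y) : (var x).val Φ ⟶ (var y).val Φ := f

/-- The identity, regarded as an isomorphism from the value of an expression, taken as a variable, to
that expression. It is not an instance of `can`: the two expressions have different summands. -/
noncomputable def unquote (e : Expr A) : (var (e.val Φ)).val Φ ≅ e.val Φ := Iso.refl _

/-- The identity, regarded as an isomorphism from the result of an operation, taken as a variable, to
the operation applied to variables. As with `unquote`, the two expressions have different summands. -/
noncomputable def unpack {n : ℕ} (a : SumWord n) (x : Fin n → A) :
    (var ((act Φ a).obj x)).val Φ ≅ (op a fun i => var (x i)).val Φ := Iso.refl _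

theorem ofHom_unquote {e e' : Expr A} (f : e.val Φ ⟶ e'.val Φ) :
    ofHom Φ f ≫ (unquote Φ e').hom = (unquote Φ e).hom ≫ f :=
  (Category.comp_id _).trans (Category.id_comp _).symm

theorem ofHom_tmap_unpack {n : ℕ} (a : SumWord n) {x y : Fin n → A} (f : ∀ i, x i ⟶ y i) :
    ofHom Φ (tmap (act Φ a) f) ≫ (unpack Φ a y).hom =
      (unpack Φ a x).hom ≫ opMap Φ a fun i => ofHom Φ (f i) :=
  (Category.comp_id _).trans (Category.id_comp _).symm

theorem unpack_unquote {n : ℕ} (a : SumWord n) (t : Fin n → Expr A) :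
    (unpack Φ a fun i => (t i).val Φ).hom ≫ opMap Φ a (fun i => (unquote Φ (t i)).hom) =
      (unquote Φ (op a t)).hom :=
  (Category.id_comp _).trans ((act Φ a).map_id _)

theorem ofHom_cohTo {n : ℕ} (a b : SumWord n) (h : a.content = b.content) (x : Fin n → A) :
    ofHom Φ ((cohTo Φ a b h).app x) ≫ (unpack Φ b x).hom =
      (unpack Φ a x).hom ≫ can Φ _ _ (mset_op_congr h fun _ => rfl) := by
  rw [can_cohTo Φ a b h]
  exact (Category.comp_id _).trans (Category.id_comp _).symm

theorem ofHom_op_one (x : Fin 1 → A) : ofHom Φ (eqToHom (act_var Φ 0 x)) =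
    (unpack Φ (Word.var 0) x).hom ≫ can Φ _ _ (mset_op_one fun i => var (x i)) := by
  rw [can_op_one]
  exact (Category.id_comp _).symm

theorem ofHom_op_rename {m n : ℕ} (f : Fin m → Fin n) (a : SumWord m) (x : Fin n → A) :
    ofHom Φ (eqToHom (act_rename Φ f a x)) ≫ (unpack Φ a fun i => x (f i)).hom =
      (unpack Φ (a.rename f) x).hom ≫ can Φ _ _ (mset_op_rename f a fun i => var (x i)) := by
  rw [can_op_rename]
  exact (Category.comp_id _).trans (Category.id_comp _).symm

theorem ofHom_op_plug {k : ℕ} {n : Fin k → ℕ} (a : SumWord k) (b : ∀ i, SumWord (n i))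
    (x : Fin (∑ i, n i) → A) :
    ofHom Φ (eqToHom (act_plug Φ a b x)) ≫
        (unpack Φ a fun i => (act Φ (b i)).obj fun j => x (blk i j)).hom ≫
        opMap Φ a (fun i => (unpack Φ (b i) fun j => x (blk i j)).hom) =
      (unpack Φ (a.plug b) x).hom ≫ can Φ _ _ (mset_op_plug a b fun i => var (x i)) := by
  rw [can_op_plug]
  refine Eq.trans ?_ (Category.id_comp _).symm
  refine (congrArg (_ ≫ ·) ((Category.id_comp _).trans ((act Φ a).map_id _))).trans ?_
  exact Category.comp_id _

end Expr

namespace Strict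

variable {A : Type u} [Category.{v} A] {Φ : PseudoAlgebra commMonoidTheory fullSet A}

/-- An isomorphism between the values of the representing expressions, as one of the strictification. -/
@[simps]
def mkIso {M N : Strict Φ} (e : M.expr.val Φ ≅ N.expr.val Φ) : M ≅ N where
  hom := ⟨e.hom⟩
  inv := ⟨e.inv⟩

variable (Φ) in
/-- The strictification, considered as a pseudo algebra. -/
noncomputable abbrev pseudo : PseudoAlgebra commMonoidTheory fullSet (Strict Φ) :=
  (algebra Φ).toPseudo fullSet

/-- The components of the coherence maps of the strictification. -/
noncomputable def sumCoh {n : ℕ} (a b : SumWord n) (h : a.content = b.content)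
    (M : Fin n → Strict Φ) : sum a.content M ⟶ sum b.content M :=
  (cohTo (pseudo Φ) a b h).app M

@[simp] theorem sumCoh_hom {n : ℕ} (a b : SumWord n) (h : a.content = b.content)
    (M : Fin n → Strict Φ) :
    (sumCoh a b h M).hom =
      Expr.can Φ (sum a.content M).expr (sum b.content M).expr (by rw [h]) := by
  have e : cohTo (pseudo Φ) a b h = eqToHom (congrArg strictOp h) :=
    (congrArg (eqToHom _ ≫ ·) (Category.id_comp _)).trans (eqToHom_trans _ _)
  rw [sumCoh, e, eqToHom_app, eqToHom_hom]
  rfl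

/-! ### The pseudo morphisms between a pseudo algebra and its strictification -/

variable (Φ) in
/-- An object of `A`, considered as a multiset with one element. -/
def single (x : A) : Strict Φ := ⟨{x}⟩

theorem mset_single (x : A) : (single Φ x).expr.mset = (Expr.var x).mset := Expr.mset_rep _

variable (Φ) in
/-- A morphism of `A`, considered as a morphism between multisets with one element. -/
noncomputable def singleMap {x y : A} (f : x ⟶ y) : single Φ x ⟶ single Φ y :=
  ⟨Expr.can Φ _ _ (mset_single x) ≫ Expr.ofHom Φ f ≫ Expr.can Φ _ _ (mset_single y).symm⟩

@[simp] theorem singleMap_hom {x y : A} (f : x ⟶ y) : (singleMap Φ f).hom =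
  Expr.can Φ _ _ (mset_single x) ≫ Expr.ofHom Φ f ≫ Expr.can Φ _ _ (mset_single y).symm := rfl

variable (Φ) in
/-- The functor `x ↦ {x}` from a pseudo algebra to its strictification. -/
noncomputable def incl : A ⥤ Strict Φ where
  obj := single Φ
  map f := singleMap Φ f
  map_id x := by
    ext
    refine (congrArg (_ ≫ ·) (Category.id_comp _)).trans ?_
    simp
  map_comp {x y z} f g := by
    ext
    have : Expr.ofHom Φ (f ≫ g) = Expr.ofHom Φ f ≫ Expr.ofHom Φ g := rfl
    simp [this]

/-- Sums of morphisms of the strictification. -/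
noncomputable def sumHom {n : ℕ} (w : Multiset (Fin n)) {M N : Fin n → Strict Φ}
    (f : ∀ i, M i ⟶ N i) : sum w M ⟶ sum w N := tmap (strictOp w) f

variable (Φ) in
/-- The functor from the strictification to the pseudo algebra that evaluates multisets. -/
@[simps]
noncomputable def eval : Strict Φ ⥤ A where
  obj M := M.expr.val Φ
  map f := f.hom

theorem mset_op_single {n : ℕ} (a : SumWord n) (x : Fin n → A) :
    (Expr.op a fun i => Expr.var (x i)).mset =
      (sum a.content fun i => single Φ (x i)).expr.mset := by
  rw [← mset_op rfl]
  exact Expr.mset_op_congr rfl fun i => (mset_single (x i)).symm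

open Laplaza.Expr in
variable (Φ) in
/-- The structure isomorphism of `incl`: the value of a word `a` at `x` is first taken apart into the
expression `a(x₁, …, x_n)`, whose summands are then collected. -/
noncomputable def inclStr {n : ℕ} (a : SumWord n) (x : Fin n → A) :
    single Φ ((act Φ a).obj x) ≅ sum a.content fun i => single Φ (x i) :=
  mkIso (canIso Φ _ _ (mset_single ((act Φ a).obj x)) ≪≫ unpack Φ a x ≪≫
    canIso Φ _ _ (mset_op_single a x))

open Laplaza.Expr in
@[simp] theorem inclStr_hom_hom {n : ℕ} (a : SumWord n) (x : Fin n → A) :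
    (inclStr Φ a x).hom.hom = can Φ _ _ (mset_single ((act Φ a).obj x)) ≫ (unpack Φ a x).hom ≫
      can Φ _ _ (mset_op_single a x) := rfl

open Laplaza.Expr in
theorem sumHom_hom {n : ℕ} (a : SumWord n) {M N : Fin n → Strict Φ} (f : ∀ i, M i ⟶ N i) :
    (sumHom a.content f).hom = can Φ _ _ (mset_op rfl M).symm ≫
      opMap Φ a (fun i => (f i).hom) ≫ can Φ _ _ (mset_op rfl N) := strictOp_map_hom rfl f

theorem eqToHom_single {x y : A} (h : x = y) (h' : single Φ x = single Φ y) :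
    eqToHom h' = singleMap Φ (eqToHom h) := (eqToHom_map (incl Φ) h).symm

open Laplaza.Expr in
theorem inclStr_naturality {n : ℕ} (a : SumWord n) {x y : Fin n → A} (f : ∀ i, x i ⟶ y i) :
    singleMap Φ (tmap (act Φ a) f) ≫ (inclStr Φ a y).hom =
      (inclStr Φ a x).hom ≫ sumHom a.content fun i => singleMap Φ (f i) := by
  ext
  rw [comp_hom, comp_hom, sumHom_hom a]
  have h := ofHom_tmap_unpack Φ a f
  simp [opMap_comp, reassoc_of% h]

open Laplaza.Expr in
theorem inclStr_coh {n : ℕ} (a b : SumWord n) (h : a.content = b.content) (x : Fin n → A) :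
    singleMap Φ ((cohTo Φ a b h).app x) ≫ (inclStr Φ b x).hom =
      (inclStr Φ a x).hom ≫ sumCoh a b h fun i => single Φ (x i) := by
  ext
  have h := ofHom_cohTo Φ a b h x
  simp [reassoc_of% h]

open Laplaza.Expr in
theorem inclStr_one (x : Fin 1 → A)
    (h : sum (Word.content (Word.var 0)) (fun i => single Φ (x i)) = single Φ (x 0)) :
    (inclStr Φ (Word.var 0) x).hom =
      singleMap Φ (eqToHom (act_var Φ 0 x)) ≫ eqToHom h.symm := by
  ext
  simp [ofHom_op_one]

open Laplaza.Expr in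
theorem inclStr_rename {m n : ℕ} (f : Fin m → Fin n) (a : SumWord m) (x : Fin n → A)
    (h : sum (Word.content (a.rename f)) (fun i => single Φ (x i)) =
      sum a.content fun i => single Φ (x (f i))) :
    (inclStr Φ (a.rename f) x).hom =
      singleMap Φ (eqToHom (act_rename Φ f a x)) ≫ (inclStr Φ a fun i => x (f i)).hom ≫
        eqToHom h.symm := by
  ext
  have h := ofHom_op_rename Φ f a x
  simp [reassoc_of% h]

open Laplaza.Expr in
theorem inclStr_plug {k : ℕ} {n : Fin k → ℕ} (a : SumWord k) (b : ∀ i, SumWord (n i))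
    (x : Fin (∑ i, n i) → A)
    (h : sum (Word.content (a.plug b)) (fun p => single Φ (x p)) =
      sum a.content fun i => sum (b i).content fun j => single Φ (x (blk i j))) :
    (inclStr Φ (a.plug b) x).hom =
      singleMap Φ (eqToHom (act_plug Φ a b x)) ≫
        (inclStr Φ a fun i => (act Φ (b i)).obj fun j => x (blk i j)).hom ≫
        sumHom a.content (fun i => (inclStr Φ (b i) fun j => x (blk i j)).hom) ≫
        eqToHom h.symm := by
  ext
  have h := ofHom_op_plug Φ a b x
  rw [comp_hom, comp_hom, comp_hom, sumHom_hom a]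
  simp [opMap_comp, reassoc_of% h]

theorem exists_iota {n : ℕ} (α : LapMor fullSet n) :
    ∃ (a b : SumWord n) (h : a.content = b.content), α = iota a b h := by
  obtain ⟨a, b, β, rfl⟩ := α.exists_cls
  exact ⟨a, b, β.proj_eq, eq_iota _ a b β.proj_eq rfl rfl⟩

variable (Φ) in
/-- The functor `incl` as a pseudo morphism. -/
noncomputable def inclHom : PseudoHom (C := laplazaTheory fullSet) Φ (pseudo Φ) where
  functor := incl Φ
  str a x := inclStr Φ a x
  str_naturality a _ _ f := inclStr_naturality a f
  str_coh {n} α x := by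
    obtain ⟨a, b, h, rfl⟩ := exists_iota α
    exact inclStr_coh a b h x
  str_one x := (inclStr_one x ((pseudo Φ).op_one fun i => single Φ (x i))).trans
    (congrArg (· ≫ _) (eqToHom_single _ _).symm)
  str_map f a x := (inclStr_rename f a x ((pseudo Φ).op_map f a fun i => single Φ (x i))).trans
    (congrArg (· ≫ _) (eqToHom_single _ _).symm)
  str_γ a b x := (inclStr_plug a b x ((pseudo Φ).op_γ a b fun p => single Φ (x p))).trans
    (congrArg (· ≫ _) (eqToHom_single _ _).symm)

theorem eqToHom_eval {M N : Strict Φ} (h : M = N) (h' : M.expr.val Φ = N.expr.val Φ) :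
    eqToHom h' = Expr.can Φ M.expr N.expr (by rw [h]) := by
  subst h
  simp

open Laplaza.Expr in
theorem sumHom_can {n : ℕ} (a : SumWord n) {M N : Fin n → Strict Φ} (f : ∀ i, M i ⟶ N i) :
    (sumHom a.content f).hom ≫ can Φ _ _ (mset_op rfl N).symm =
      can Φ _ _ (mset_op rfl M).symm ≫ opMap Φ a fun i => (f i).hom := by
  rw [sumHom_hom]
  simp

open Laplaza.Expr in
theorem sumCoh_can {n : ℕ} (a b : SumWord n) (h : a.content = b.content) (M : Fin n → Strict Φ) :
    (sumCoh a b h M).hom ≫ can Φ _ _ (mset_op rfl M).symm =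
      can Φ _ _ (mset_op rfl M).symm ≫ (cohTo Φ a b h).app fun i => (M i).expr.val Φ := by
  have e := can_cohTo Φ a b h (fun i => (M i).expr) (mset_op_congr h fun _ => rfl)
  refine Eq.trans ?_ (congrArg (can Φ _ _ (mset_op rfl M).symm ≫ ·) e)
  simp

open Laplaza.Expr in
theorem can_sum_one (M : Fin 1 → Strict Φ)
    (h : sum (Word.content (Word.var 0)) M = M 0)
    (h₁ : (sum (Word.content (Word.var 0)) M).expr.val Φ = (M 0).expr.val Φ)
    (h₂ : (M 0).expr.val Φ = (op (Word.var 0) fun i => (M i).expr).val Φ) :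
    can Φ _ _ (mset_op (a := Word.var 0) rfl M).symm = eqToHom h₁ ≫ eqToHom h₂ := by
  have e : _ = eqToHom h₂ := can_op_one_symm Φ fun i => (M i).expr
  rw [eqToHom_eval h, ← e]
  simp

open Laplaza.Expr in
theorem can_sum_rename {m n : ℕ} (f : Fin m → Fin n) (a : SumWord m) (M : Fin n → Strict Φ)
    (h : sum (Word.content (a.rename f)) M = sum a.content fun i => M (f i))
    (h₁ : (sum (Word.content (a.rename f)) M).expr.val Φ =
      (sum a.content fun i => M (f i)).expr.val Φ)
    (h₂ : (op a fun i => (M (f i)).expr).val Φ = (op (a.rename f) fun i => (M i).expr).val Φ) :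
    can Φ _ _ (mset_op (a := a.rename f) rfl M).symm =
      eqToHom h₁ ≫ can Φ _ _ (mset_op (a := a) rfl fun i => M (f i)).symm ≫ eqToHom h₂ := by
  have e : _ = eqToHom h₂ := can_op_rename_symm Φ f a fun i => (M i).expr
  rw [eqToHom_eval h, ← e]
  simp

open Laplaza.Expr in
theorem can_sum_plug {k : ℕ} {n : Fin k → ℕ} (a : SumWord k) (b : ∀ i, SumWord (n i))
    (M : Fin (∑ i, n i) → Strict Φ)
    (h : sum (Word.content (a.plug b)) M =
      sum a.content fun i => sum (b i).content fun j => M (blk i j))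
    (h₁ : (sum (Word.content (a.plug b)) M).expr.val Φ =
      (sum a.content fun i => sum (b i).content fun j => M (blk i j)).expr.val Φ)
    (h₂ : (op a fun i => op (b i) fun j => (M (blk i j)).expr).val Φ =
      (op (a.plug b) fun i => (M i).expr).val Φ) :
    can Φ _ _ (mset_op (a := a.plug b) rfl M).symm = eqToHom h₁ ≫
      can Φ _ _ (mset_op (a := a) rfl fun i => sum (b i).content fun j => M (blk i j)).symm ≫
      opMap Φ a (fun i => can Φ _ _ (mset_op (a := b i) rfl fun j => M (blk i j)).symm) ≫
      eqToHom h₂ := by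
  have e : _ = eqToHom h₂ := can_op_plug_symm Φ a b fun i => (M i).expr
  rw [eqToHom_eval h, ← e]
  simp

variable (Φ) in
/-- The functor `eval` as a pseudo morphism; its structure isomorphisms are instances of `can`. -/
noncomputable def evalHom : PseudoHom (C := laplazaTheory fullSet) (pseudo Φ) Φ where
  functor := eval Φ
  str a M := Expr.canIso Φ _ _ (mset_op (a := a) rfl M).symm
  str_naturality a _ _ f := sumHom_can a f
  str_coh {n} α x := by
    obtain ⟨a, b, h, rfl⟩ := exists_iota α
    exact sumCoh_can a b h x
  str_one M := can_sum_one M ((pseudo Φ).op_one M) _ _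
  str_map f a M := can_sum_rename f a M ((pseudo Φ).op_map f a M) _ _
  str_γ a b M := can_sum_plug a b M ((pseudo Φ).op_γ a b M) _ _

/-! ### The equivalence -/

open Laplaza.Expr in
variable (Φ) in
/-- The isomorphism between an object of `A` and the value of its one-element multiset. -/
noncomputable def unitIso : 𝟭 A ≅ incl Φ ⋙ eval Φ :=
  NatIso.ofComponents (fun x => canIso Φ (var x) (single Φ x).expr (mset_single x).symm)
    fun {x y} f => by
      change ofHom Φ f ≫ can Φ (var y) (single Φ y).expr (mset_single y).symm =
        can Φ (var x) (single Φ x).expr (mset_single x).symm ≫ (singleMap Φ f).hom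
      simp

open Laplaza.Expr in
/-- The isomorphism between the one-element multiset on the value of `M`, and `M`. -/
noncomputable def counitApp (M : Strict Φ) : single Φ (M.expr.val Φ) ≅ M :=
  mkIso (canIso Φ _ _ (mset_single (M.expr.val Φ)) ≪≫ unquote Φ M.expr)

open Laplaza.Expr in
variable (Φ) in
/-- The isomorphisms `counitApp`, as a natural isomorphism. -/
noncomputable def counitIso : eval Φ ⋙ incl Φ ≅ 𝟭 (Strict Φ) :=
  NatIso.ofComponents (fun M => counitApp M) fun {M N} f => by
    change singleMap Φ f.hom ≫ (counitApp N).hom = (counitApp M).hom ≫ f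
    ext
    simp [counitApp, ofHom_unquote]

open Laplaza.Expr in
theorem unit_twoCell {n : ℕ} (a : SumWord n) (x : Fin n → A) :
    (unpack Φ a x).hom ≫
        opMap Φ a (fun i => can Φ (var (x i)) (single Φ (x i)).expr (mset_single (x i)).symm) =
      can Φ (var ((act Φ a).obj x)) (single Φ ((act Φ a).obj x)).expr (mset_single _).symm ≫
        (inclStr Φ a x).hom.hom ≫ can Φ _ _ (mset_op rfl fun i => single Φ (x i)).symm := by
  simp

open Laplaza.Expr in
theorem counit_twoCell {n : ℕ} (a : SumWord n) (M : Fin n → Strict Φ) :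
    (singleMap Φ (y := (act Φ a).obj fun i => (M i).expr.val Φ)
          (can Φ _ _ (mset_op (a := a) rfl M).symm) ≫
        (inclStr Φ a fun i => (M i).expr.val Φ).hom) ≫
        sumHom a.content (fun i => (counitApp (M i)).hom) =
      (counitApp (sum a.content M)).hom := by
  have key : ∀ c : (sum a.content M).expr.val Φ ⟶ (act Φ a).obj fun i => (M i).expr.val Φ,
      ofHom Φ c ≫ (unpack Φ a fun i => (M i).expr.val Φ).hom ≫
          opMap Φ a (fun i => (unquote Φ (M i).expr).hom) =
        (unquote Φ (sum a.content M).expr).hom ≫ can Φ _ _ (mset_op (a := a) rfl M).symm →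
      (singleMap Φ c ≫ (inclStr Φ a fun i => (M i).expr.val Φ).hom) ≫
        sumHom a.content (fun i => (counitApp (M i)).hom) =
      (counitApp (sum a.content M)).hom := fun c h => by
    ext
    rw [comp_hom, comp_hom, sumHom_hom a]
    simp [counitApp, opMap_comp, reassoc_of% h]
  refine key _ ?_
  refine (congrArg (_ ≫ ·) (unpack_unquote Φ a fun i => (M i).expr)).trans ?_
  exact ofHom_unquote Φ _

open Laplaza.Expr in
variable (Φ) in
/-- A pseudo algebra is equivalent to its strictification. -/
noncomputable def equivalence :
    AlgebraEquivalence (C := laplazaTheory fullSet) Φ (pseudo Φ) where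
  hom := inclHom Φ
  inv := evalHom Φ
  unitIso := unitIso Φ
  counitIso := counitIso Φ
  unit_twoCell a x := unit_twoCell a x
  counit_twoCell a M := (counit_twoCell a M).trans (Category.comp_id _).symm

end Strict
end Laplaza

theorem proposition2p5 {A : Type u} [Category.{v} A]
    (Φ : Laplaza.PseudoAlgebra Laplaza.commMonoidTheory (fun _ => Set.univ) A) :
    ∃ (A' : Type u) (_ : Category.{v} A') (Ψ : Laplaza.StrictAlgebra Laplaza.commMonoidTheory A'),
      Nonempty (Laplaza.AlgebraEquivalence Φ (Ψ.toPseudo fun _ => Set.univ)) :=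
  ⟨Laplaza.Strict Φ, inferInstance, Laplaza.Strict.algebra Φ, ⟨Laplaza.Strict.equivalence Φ⟩⟩
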